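/- Consider partial Boolean functions $f:\{0,1\}^n\times\{0,1\}^m\to\{0,1,\bot\}$, where $\bot$ means undefined. In a QMA communication protocol for $f$, Alice gets $x$, Bob gets $y$, and the prover Merlin, who knows $x$ and $y$, first sends a quantum proof, some qubits of it to Alice and some (possibly none) to Bob. Then Alice and Bob, who share neither entanglement nor randomness, alternately exchange quantum messages; either of them may start, each uses arbitrary local quantum operations, which depend on the player's own input only, and the receiver of the last message measures and outputs accept or reject (if there is no message, a fixed player does). The number of rounds is the number of messages between Alice and Bob, and the cost is the total number of qubits of the proof and of these messages. The protocol computes $f$ if for all $(x,y)$ with $f(x,y)=1$ there is a proof (a quantum state) that is accepted with probability at least $2/3$, and for all $(x,y)$ with $f(x,y)=0$ every proof is accepted with probability at most $1/3$. In a one-way QMA protocol, Merlin sends a quantum proof to Alice only, Alice sends one quantum message to Bob, and Bob gives the output; cost and correctness are as before, and $QMA^{A\to B}(f)$ is the minimum cost of a one-way QMA protocol that computes $f$. For every $r\in\mathbb{N}$ there is a constant $C$, which depends only on $r$, such that for all $n,m$, all partial Boolean functions $f:\{0,1\}^n\times\{0,1\}^m\to\{0,1,\bot\}$ and all $c\geq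 1$: if $f$ is computed by a QMA communication protocol of cost at most $c$ with at most $r$ rounds, then $QMA^{A\to B}(f)\leq C\cdot c$. -/

import Mathlib

open scoped Matrix Kronecker ComplexOrder

/-- The index set of the computational basis of a system of `k` qubits. -/
abbrev Qubits (k : ℕ) : Type := Fin k → Bool

/-- Quantum states (density matrices): positive semidefinite of trace one. -/
def IsState {ι : Type} [Fintype ι] (ρ : Matrix ι ι ℂ) : Prop :=
  ρ.PosSemidef ∧ ρ.trace = 1

/-- Isometries. An isometry between systems of qubits is a unitary applied after adjoining
fresh qubits in state `|0⟩`; as local workspaces are kept and their size is unrestricted, local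
isometries realise every local quantum operation (including private coins and measurements). -/
def IsIsometry {ι κ : Type} [Fintype ι] [Fintype κ] [DecidableEq ι] (V : Matrix κ ι ℂ) : Prop :=
  Vᴴ * V = 1

/-- Effects `0 ≤ E ≤ 1`: the element "accept" of a two-outcome measurement (POVM). -/
def IsEffect {ι : Type} [Fintype ι] [DecidableEq ι] (E : Matrix ι ι ℂ) : Prop :=
  E.PosSemidef ∧ (1 - E).PosSemidef

/-- The two players who receive inputs. -/
inductive Player where
  | alice
  | bob

/-- The opponent of a player. -/
def Player.other : Player → Player
  | .alice => .bob
  | .bob => .alice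

/-- The input of each player: `x ∈ X` for Alice, `y ∈ Y` for Bob. -/
def Player.Input (X Y : Type) : Player → Type
  | .alice => X
  | .bob => Y

/-- The input that player `p` sees when the joint input is `(x, y)`. -/
def Player.view {X Y : Type} (x : X) (y : Y) : (p : Player) → p.Input X Y
  | .alice => x
  | .bob => y

/-- The player who acts at time `i`, when `first` acts at time `0` and the players alternate. -/
def Player.turn (first : Player) : ℕ → Player
  | 0 => first
  | i + 1 => (Player.turn first i).other

/-- The verification condition of quantum Merlin-Arthur protocols with error `1/3` for a partial
Boolean function `f` (`none` means undefined). Here `acc x y ρ` is the probability that the input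
`(x, y)` is accepted when Merlin's proof is the state `ρ`. -/
def VerifiesQMA {X Y ι : Type} [Fintype ι] (f : X → Y → Option Bool)
    (acc : X → Y → Matrix ι ι ℂ → ℝ) : Prop :=
  ∀ x y,
    (f x y = some true → ∃ ρ, IsState ρ ∧ 2 / 3 ≤ acc x y ρ) ∧
    (f x y = some false → ∀ ρ, IsState ρ → acc x y ρ ≤ 1 / 3)

/-- A (two-way) QMA communication protocol without shared entanglement or shared randomness.

Merlin sends a proof: `work 0` qubits go to the player `first`, and `work 1` qubits (possibly
none) go to the other player; the two parts may be entangled. Then `rounds` messages are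
exchanged, with alternating senders. At time `i` the acting player `turn first i` holds `work i`
private qubits and the last message, of `msg i` qubits (no message at time `0`), while the other
player holds `work (i + 1)` private qubits. The acting player turns what she or he holds into
`work (i + 2)` private qubits and a message of `msg (i + 1)` qubits, by an isometry that depends
on her or his own input only, and sends the message. At time `rounds` the acting player (the
receiver of the last message) makes a measurement and gives the output. -/
structure QMAProtocol (X Y : Type) where
  first : Player
  rounds : ℕ
  work : ℕ → ℕ
  msg : ℕ → ℕ
  msg_zero : msg 0 = 0
  op : (i : ℕ) → (first.turn i).Input X Y →
    Matrix (Qubits (work (i + 2)) × Qubits (msg (i + 1))) (Qubits (work i) × Qubits (msg i)) ℂ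
  op_isometry : ∀ i < rounds, ∀ z, IsIsometry (op i z)
  accept : (first.turn rounds).Input X Y →
    Matrix (Qubits (work rounds) × Qubits (msg rounds))
      (Qubits (work rounds) × Qubits (msg rounds)) ℂ
  accept_effect : ∀ z, IsEffect (accept z)

namespace QMAProtocol

variable {X Y : Type}

/-- The basis of the joint system at time `i`: private qubits of the acting player, last message,
private qubits of the other player. -/
abbrev Stage (P : QMAProtocol X Y) (i : ℕ) : Type :=
  (Qubits (P.work i) × Qubits (P.msg i)) × Qubits (P.work (i + 1))

/-- The evolution of the joint system from time `i` to time `i + 1`: the acting player applies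
`op i` to the own private qubits and the last message; the qubits of the other player, who acts
next, are untouched. -/
def step (P : QMAProtocol X Y) (x : X) (y : Y) (i : ℕ) :
    Matrix (P.Stage (i + 1)) (P.Stage i) ℂ :=
  Matrix.of fun s t =>
    P.op i (Player.view x y (P.first.turn i)) (s.2, s.1.2) t.1 * (if s.1.1 = t.2 then 1 else 0)

/-- The evolution of the joint system from time `0` to time `i`. -/
def evolve (P : QMAProtocol X Y) (x : X) (y : Y) : (i : ℕ) → Matrix (P.Stage i) (P.Stage 0) ℂ
  | 0 => 1
  | i + 1 => P.step x y i * P.evolve x y i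

/-- The probability that `(x, y)` is accepted with proof `ρ`. -/
noncomputable def acceptProb (P : QMAProtocol X Y) (x : X) (y : Y)
    (ρ : Matrix (P.Stage 0) (P.Stage 0) ℂ) : ℝ :=
  ((P.accept (Player.view x y (P.first.turn P.rounds)) ⊗ₖ
      (1 : Matrix (Qubits (P.work (P.rounds + 1))) (Qubits (P.work (P.rounds + 1))) ℂ)) *
    (P.evolve x y P.rounds * ρ * (P.evolve x y P.rounds)ᴴ)).trace.re

/-- The cost: the length of the proof plus the length of all messages between the players. -/
def cost (P : QMAProtocol X Y) : ℕ :=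
  (P.work 0 + P.work 1) + ∑ i ∈ Finset.range P.rounds, P.msg (i + 1)

/-- `P` is a correct QMA protocol (error `1/3`) for the partial function `f`. -/
def Computes (P : QMAProtocol X Y) (f : X → Y → Option Bool) : Prop :=
  VerifiesQMA f P.acceptProb

end QMAProtocol

/-- A one-way QMA protocol without shared entanglement or shared randomness: Merlin sends
a quantum proof of `proofLen` qubits to Alice, who applies an isometry that depends on `x`, keeps
`work` qubits and sends `msgLen` qubits to Bob, who makes a measurement that depends on `y` and
gives the output. -/
structure OneWayQMAProtocol (X Y : Type) where
  proofLen : ℕ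
  work : ℕ
  msgLen : ℕ
  alice : X → Matrix (Qubits work × Qubits msgLen) (Qubits proofLen) ℂ
  alice_isometry : ∀ x, IsIsometry (alice x)
  bob : Y → Matrix (Qubits msgLen) (Qubits msgLen) ℂ
  bob_effect : ∀ y, IsEffect (bob y)

namespace OneWayQMAProtocol

variable {X Y : Type}

/-- The probability that Bob accepts on `(x, y)` with proof `ρ`. -/
noncomputable def acceptProb (P : OneWayQMAProtocol X Y) (x : X) (y : Y)
    (ρ : Matrix (Qubits P.proofLen) (Qubits P.proofLen) ℂ) : ℝ :=
  (((1 : Matrix (Qubits P.work) (Qubits P.work) ℂ) ⊗ₖ P.bob y) *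
    (P.alice x * ρ * (P.alice x)ᴴ)).trace.re

/-- The cost: the length of the proof plus the length of Alice's message. -/
def cost (P : OneWayQMAProtocol X Y) : ℕ := P.proofLen + P.msgLen

/-- `P` is a correct one-way QMA protocol (error `1/3`) for the partial function `f`. -/
def Computes (P : OneWayQMAProtocol X Y) (f : X → Y → Option Bool) : Prop :=
  VerifiesQMA f P.acceptProb

end OneWayQMAProtocol

/-- The one-way QMA communication complexity: the least cost of a correct one-way QMA protocol
(`⊤` if there were none). -/
noncomputable def oneWayQMA {X Y : Type} (f : X → Y → Option Bool) : ℕ∞ :=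
  ⨅ (P : OneWayQMAProtocol X Y) (_ : P.Computes f), (P.cost : ℕ∞)

/-! Merlin sends to Alice the history of the whole two-way protocol, a superposition of the joint
states at the times 0, …, R, in the manner of Kitaev's circuit-to-Hamiltonian construction. The
transition from time `t` to time `t + 1` is an operation of a single player, so each constraint on
the history can be checked by one player alone. Alice tosses a fair coin: she tests her own
constraints and sends the verdict, or she forwards the history to Bob, who tests his
(`IsOneWayAcceptance.mix`). Nothing has to be checked at time 0, since the initial state is Merlin's
arbitrary proof and fresh workspace is part of the isometries.

A violated constraint or a rejecting end is charged by `HistoryState.penalty`. An honest history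
pays only for its rejection probability, at most 1/3 (`IsFrame.penalty_history`). Conversely, small
defects force every component to be close to the evolution of the initial one, so on a 0-input any
vector pays for a rejection probability of at least 2/3, up to small losses (`le_quadForm_penalty`).
The gap depends on R only, and constantly many parallel repetitions, an OR of ANDs, amplify it
(`HasOneWayProtocol.exists_amplification`).

The history must also be short, although private workspaces are not counted in the cost. The states
which a private register can reach span a space whose dimension grows at each action by at most the
dimensions of the message received and the message sent. This space depends on the owner's input
only, so the owner can compress the register to at most `cost` qubits (`QMAProtocol.decompress`,
`dim_le`); then `R + 3 * cost` qubits hold the history. -/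

set_option linter.unusedSectionVars false

open Matrix

/-! ### Positive semidefinite matrices and effects -/

namespace Matrix

variable {ι κ : Type}

theorem PosSemidef.exists_eq_conjTranspose_mul [Fintype ι] [DecidableEq ι] {A : Matrix ι ι ℂ}
    (hA : A.PosSemidef) : ∃ B : Matrix ι ι ℂ, A = Bᴴ * B := by
  open scoped MatrixOrder in
  exact CStarAlgebra.nonneg_iff_eq_star_mul_self.mp hA.nonneg

theorem PosSemidef.trace_mul_nonneg [Fintype ι] [DecidableEq ι] {A B : Matrix ι ι ℂ}
    (hA : A.PosSemidef) (hB : B.PosSemidef) : 0 ≤ (A * B).trace := by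
  obtain ⟨C, rfl⟩ := hB.exists_eq_conjTranspose_mul
  rw [← Matrix.mul_assoc, trace_mul_comm, ← Matrix.mul_assoc]
  exact (hA.mul_mul_conjTranspose_same C).trace_nonneg

theorem PosSemidef.complex_kronecker [Fintype ι] [Fintype κ] {A : Matrix ι ι ℂ} {B : Matrix κ κ ℂ}
    (hA : A.PosSemidef) (hB : B.PosSemidef) : (A ⊗ₖ B).PosSemidef :=
  hA.kronecker hB

/-- The matrix of an injection of basis states. -/
def ofInjection [DecidableEq κ] (φ : ι → κ) : Matrix κ ι ℂ :=
  Matrix.of fun k i => if k = φ i then 1 else 0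

theorem ofInjection_isometry [Fintype κ] [DecidableEq ι] [DecidableEq κ] {φ : ι → κ}
    (hφ : Function.Injective φ) : (ofInjection φ)ᴴ * ofInjection φ = 1 := by
  ext i j
  simp [ofInjection, mul_apply, one_apply, hφ.eq_iff, eq_comm]

end Matrix

theorem IsEffect.one_sub {ι : Type} [Fintype ι] [DecidableEq ι] {E : Matrix ι ι ℂ}
    (h : IsEffect E) : IsEffect (1 - E) :=
  ⟨h.2, by simpa using h.1⟩

theorem IsEffect.conj {ι κ : Type} [Fintype ι] [Fintype κ] [DecidableEq ι] [DecidableEq κ]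
    {E : Matrix ι ι ℂ} (h : IsEffect E) {V : Matrix ι κ ℂ} (hV : Vᴴ * V = 1) :
    IsEffect (Vᴴ * E * V) := by
  refine ⟨h.1.conjTranspose_mul_mul_same V, ?_⟩
  have := h.2.conjTranspose_mul_mul_same V
  rwa [Matrix.mul_sub, Matrix.sub_mul, Matrix.mul_one, hV] at this

/-- `1 - V * E * Vᴴ` is the sum of the projection `1 - V * Vᴴ` and `V * (1 - E) * Vᴴ`. This places
Bob's effect in a larger register of qubits. -/
theorem IsEffect.conj_conjTranspose {ι κ : Type} [Fintype ι] [Fintype κ] [DecidableEq ι]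
    [DecidableEq κ] {E : Matrix ι ι ℂ} (h : IsEffect E) {V : Matrix κ ι ℂ} (hV : Vᴴ * V = 1) :
    IsEffect (V * E * Vᴴ) := by
  refine ⟨h.1.mul_mul_conjTranspose_same V, ?_⟩
  have h1 : (1 - V * Vᴴ).PosSemidef := by
    have h2 : 1 - V * Vᴴ = (1 - V * Vᴴ)ᴴ * (1 - V * Vᴴ) := by
      have : V * Vᴴ * (V * Vᴴ) = V * Vᴴ := by
        rw [Matrix.mul_assoc, ← Matrix.mul_assoc Vᴴ, hV, Matrix.one_mul]
      simp [Matrix.mul_sub, Matrix.sub_mul, this]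
    rw [h2]
    exact posSemidef_conjTranspose_mul_self _
  have h3 := h1.add (h.2.mul_mul_conjTranspose_same V)
  convert h3 using 1
  simp [Matrix.mul_sub, Matrix.sub_mul]

theorem IsEffect.kronecker {ι κ : Type} [Fintype ι] [Fintype κ] [DecidableEq ι] [DecidableEq κ]
    {E : Matrix ι ι ℂ} {F : Matrix κ κ ℂ} (hE : IsEffect E) (hF : IsEffect F) :
    IsEffect (E ⊗ₖ F) := by
  refine ⟨hE.1.complex_kronecker hF.1, ?_⟩
  have h := (hE.2.complex_kronecker hF.1).add
    ((PosSemidef.one : (1 : Matrix ι ι ℂ).PosSemidef).complex_kronecker hF.2)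
  convert h using 1
  rw [← one_kronecker_one]
  ext ⟨i, j⟩ ⟨i', j'⟩
  simp only [Matrix.sub_apply, Matrix.add_apply, kroneckerMap_apply]
  ring

/-! ### Acceptance operators of one-way protocols -/

/-- `E x y` is the acceptance operator on Merlin's proof in a one-way protocol in which Alice
applies a channel with Kraus operators `A x w` and sends the output, of at most `q` qubits, to Bob,
who accepts with the effect `B y`. -/
def IsOneWayAcceptance {X Y ι : Type} [Fintype ι] [DecidableEq ι] (E : X → Y → Matrix ι ι ℂ)
    (q : ℕ) : Prop :=
  ∃ (ω κ : Type) (_ : Fintype ω) (_ : Fintype κ) (_ : DecidableEq κ)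
    (A : X → ω → Matrix κ ι ℂ) (B : Y → Matrix κ κ ℂ),
    Fintype.card κ ≤ 2 ^ q ∧ (∀ x, ∑ w, (A x w)ᴴ * A x w = 1) ∧ (∀ y, IsEffect (B y)) ∧
    ∀ x y, E x y = ∑ w, (A x w)ᴴ * B y * A x w

namespace IsOneWayAcceptance

variable {X Y ι : Type} [Fintype ι] [DecidableEq ι] {E : X → Y → Matrix ι ι ℂ} {q : ℕ}

theorem isEffect (h : IsOneWayAcceptance E q) (x : X) (y : Y) : IsEffect (E x y) := by
  obtain ⟨ω, κ, _, _, _, A, B, -, hA, hB, hE⟩ := h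
  rw [hE]
  refine ⟨posSemidef_sum _ fun w _ => (hB y).1.conjTranspose_mul_mul_same _, ?_⟩
  rw [← hA x, ← Finset.sum_sub_distrib]
  refine posSemidef_sum _ fun w _ => ?_
  have := (hB y).2.conjTranspose_mul_mul_same (A x w)
  rwa [Matrix.mul_sub, Matrix.sub_mul, Matrix.mul_one] at this

theorem one_sub (h : IsOneWayAcceptance E q) :
    IsOneWayAcceptance (fun x y => 1 - E x y) q := by
  obtain ⟨ω, κ, _, _, _, A, B, hq, hA, hB, hE⟩ := h
  refine ⟨ω, κ, inferInstance, inferInstance, inferInstance, A, fun y => 1 - B y, hq, hA,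
    fun y => (hB y).one_sub, fun x y => ?_⟩
  simp [Matrix.mul_sub, Matrix.sub_mul, Finset.sum_sub_distrib, hA, hE]

theorem kronecker (h : IsOneWayAcceptance E q) {ι' : Type} [Fintype ι'] [DecidableEq ι']
    {E' : X → Y → Matrix ι' ι' ℂ} {q' : ℕ} (h' : IsOneWayAcceptance E' q') :
    IsOneWayAcceptance (fun x y => E x y ⊗ₖ E' x y) (q + q') := by
  obtain ⟨ω, κ, _, _, _, A, B, hq, hA, hB, hE⟩ := h
  obtain ⟨ω', κ', _, _, _, A', B', hq', hA', hB', hE'⟩ := h'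
  have key : ∀ (C : ω → Matrix ι ι ℂ) (C' : ω' → Matrix ι' ι' ℂ),
      ∑ w : ω × ω', C w.1 ⊗ₖ C' w.2 = (∑ w, C w) ⊗ₖ ∑ w, C' w := by
    intro C C'
    ext ⟨i, j⟩ ⟨i', j'⟩
    simp [kroneckerMap_apply, Matrix.sum_apply, Fintype.sum_prod_type, Finset.sum_mul_sum]
  refine ⟨ω × ω', κ × κ', inferInstance, inferInstance, inferInstance,
    fun x w => A x w.1 ⊗ₖ A' x w.2, fun y => B y ⊗ₖ B' y, ?_, fun x => ?_,
    fun y => (hB y).kronecker (hB' y), fun x y => ?_⟩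
  · rw [Fintype.card_prod, pow_add]
    exact Nat.mul_le_mul hq hq'
  · simp_rw [conjTranspose_kronecker, ← mul_kronecker_mul]
    rw [key (fun w => (A x w)ᴴ * A x w) (fun w => (A' x w)ᴴ * A' x w), hA, hA', one_kronecker_one]
  · simp_rw [conjTranspose_kronecker, ← mul_kronecker_mul]
    rw [key (fun w => (A x w)ᴴ * B y * A x w) (fun w => (A' x w)ᴴ * B' y * A' x w), hE, hE']

theorem submatrix (h : IsOneWayAcceptance E q) {ι' : Type} [Fintype ι'] [DecidableEq ι']
    (e : ι' ≃ ι) : IsOneWayAcceptance (fun x y => (E x y).submatrix e e) q := by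
  obtain ⟨ω, κ, _, _, _, A, B, hq, hA, hB, hE⟩ := h
  refine ⟨ω, κ, inferInstance, inferInstance, inferInstance,
    fun x w => (A x w).submatrix id e, B, hq, fun x => ?_, hB, fun x y => ?_⟩
  · have := congrArg (fun M => M.submatrix e e) (hA x)
    ext i j
    simpa [Matrix.sum_apply, Matrix.mul_apply, one_apply] using congrFun (congrFun this i) j
  · ext i j
    simp [hE, Matrix.sum_apply, Matrix.mul_apply]

/-- Alice tosses a fair coin and either measures the effect `F x` herself or passes the proof on
to Bob, who measures the effect `G y`. -/
theorem mix {F : X → Matrix ι ι ℂ} {G : Y → Matrix ι ι ℂ} (hF : ∀ x, IsEffect (F x))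
    (hG : ∀ y, IsEffect (G y)) {k : ℕ} (hk : Fintype.card ι ≤ 2 ^ k) :
    IsOneWayAcceptance (fun x y => (1 / 2 : ℂ) • (F x + G y)) (k + 2) := by
  choose C hC using fun x => (hF x).1.exists_eq_conjTranspose_mul
  choose D hD using fun x => (hF x).2.exists_eq_conjTranspose_mul
  have hs : ((Real.sqrt (1 / 2) : ℝ) : ℂ) * (Real.sqrt (1 / 2) : ℝ) = 1 / 2 := by
    rw [← Complex.ofReal_mul, Real.mul_self_sqrt (by norm_num)]
    norm_num
  let s : ℂ := (Real.sqrt (1 / 2) : ℝ)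
  have hs' : star s = s := Complex.conj_ofReal _
  -- The message is either the forwarded proof or the verdict of Alice's own test; two extra
  -- dimensions cost at most two qubits.
  let T : Matrix (ι ⊕ Bool) ι ℂ := ofInjection Sum.inl
  have hT : Tᴴ * T = 1 := ofInjection_isometry Sum.inl_injective
  -- The Kraus operator `none` forwards the proof; `some (b, j)` writes the verdict `b`, using the
  -- row `j` of a square root of `F x` or of `1 - F x`. The factor `s` is the amplitude of the coin.
  let A : X → Option (Bool × ι) → Matrix (ι ⊕ Bool) ι ℂ := fun x w =>
    match w with
    | none => s • T
    | some (b, j) => s • Matrix.of fun k i =>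
        if k = Sum.inr b then (if b then C x j i else D x j i) else 0
  let a : Matrix (ι ⊕ Bool) (ι ⊕ Bool) ℂ := single (Sum.inr true) (Sum.inr true) 1
  let a' : Matrix (ι ⊕ Bool) (ι ⊕ Bool) ℂ := single (Sum.inr false) (Sum.inr false) 1
  have ha : ∀ b, (single (Sum.inr b : ι ⊕ Bool) (Sum.inr b) (1 : ℂ)).PosSemidef := by
    intro b
    rw [← diagonal_single]
    refine PosSemidef.diagonal fun i => ?_
    by_cases h : i = Sum.inr b <;> simp [h]
  have h1 : 1 = T * Tᴴ + a + a' := by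
    ext i j
    rcases i with i | i <;> rcases j with j | j <;>
      simp [T, a, a', ofInjection, mul_apply, one_apply, single_apply, eq_comm]
    cases i <;> cases j <;> simp
  -- Used twice: `M = 1` gives trace preservation, Bob's effect gives the acceptance operator.
  have hA0 : ∀ (M : Matrix (ι ⊕ Bool) (ι ⊕ Bool) ℂ) x,
      ∑ w, (A x w)ᴴ * M * A x w = (1 / 2 : ℂ) • (Tᴴ * M * T +
        M (Sum.inr true) (Sum.inr true) • F x + M (Sum.inr false) (Sum.inr false) • (1 - F x)) := by
    intro M x
    rw [hD, hC]
    ext i j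
    rw [← hs]
    simp only [Fintype.sum_option, Fintype.sum_prod_type, Fintype.sum_bool, Matrix.add_apply,
      Matrix.sum_apply, A, conjTranspose_smul, Matrix.smul_mul, Matrix.mul_smul, hs',
      Matrix.smul_apply, smul_eq_mul, mul_add]
    simp only [Matrix.mul_apply, conjTranspose_apply, Finset.mul_sum, Finset.sum_mul, of_apply, s]
    simp
    simp only [add_assoc, mul_assoc, mul_left_comm, mul_comm]
  refine ⟨Option (Bool × ι), ι ⊕ Bool, inferInstance, inferInstance, inferInstance, A,
    fun y => T * G y * Tᴴ + a, ?_, fun x => ?_, fun y => ⟨?_, ?_⟩, fun x y => ?_⟩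
  · have := Nat.one_le_two_pow (n := k)
    rw [Fintype.card_sum, Fintype.card_bool, pow_add]
    omega
  · have := hA0 1 x
    simp only [Matrix.mul_one] at this
    rw [this, hT]
    ext i j
    simp
    ring
  · exact ((hG y).1.mul_mul_conjTranspose_same T).add (ha true)
  · have := ((hG y).2.mul_mul_conjTranspose_same T).add (ha false)
    convert this using 1
    rw [h1]
    simp only [Matrix.mul_sub, Matrix.sub_mul, Matrix.mul_one, a, a']
    abel
  · rw [hA0]
    have e1 : Tᴴ * (T * G y * Tᴴ + a) * T = G y := by
      have : Tᴴ * a = 0 := by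
        ext i j
        simp [T, a, ofInjection, mul_apply, single_apply]
      rw [Matrix.mul_add, Matrix.add_mul, this, Matrix.zero_mul, add_zero,
        show Tᴴ * (T * G y * Tᴴ) * T = (Tᴴ * T) * G y * (Tᴴ * T) by simp only [Matrix.mul_assoc],
        hT, Matrix.one_mul, Matrix.mul_one]
    rw [e1]
    have e2 : ∀ b, (T * G y * Tᴴ + a) (Sum.inr b) (Sum.inr b) = if b then 1 else 0 := by
      intro b
      cases b <;> simp [T, a, ofInjection, mul_apply]
    simp [e2, add_comm]

end IsOneWayAcceptance

theorem IsState.kronecker {ι κ : Type} [Fintype ι] [Fintype κ] {ρ : Matrix ι ι ℂ}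
    {σ : Matrix κ κ ℂ} (hρ : IsState ρ) (hσ : IsState σ) : IsState (ρ ⊗ₖ σ) :=
  ⟨hρ.1.complex_kronecker hσ.1, by rw [trace_kronecker, hρ.2, hσ.2, mul_one]⟩

theorem IsState.submatrix {ι κ : Type} [Fintype ι] [Fintype κ] {ρ : Matrix ι ι ℂ}
    (hρ : IsState ρ) (e : κ ≃ ι) : IsState (ρ.submatrix e e) :=
  ⟨hρ.1.submatrix e, by rw [← hρ.2]; exact Fintype.sum_equiv e _ _ fun _ => rfl⟩

theorem IsState.conj {ι κ : Type} [Fintype ι] [Fintype κ] [DecidableEq ι] {ρ : Matrix ι ι ℂ}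
    (hρ : IsState ρ) {V : Matrix κ ι ℂ} (hV : Vᴴ * V = 1) : IsState (V * ρ * Vᴴ) :=
  ⟨hρ.1.mul_mul_conjTranspose_same V, by
    rw [trace_mul_comm, ← Matrix.mul_assoc, hV, Matrix.one_mul, hρ.2]⟩

theorem IsEffect.trace_mul_le_one {ι : Type} [Fintype ι] [DecidableEq ι] {E ρ : Matrix ι ι ℂ}
    (hE : IsEffect E) (hρ : IsState ρ) : (E * ρ).trace ≤ 1 := by
  have := hE.2.trace_mul_nonneg hρ.1
  rwa [Matrix.sub_mul, Matrix.one_mul, trace_sub, hρ.2, sub_nonneg] at this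

/-- The matrix `|w⟩ ⊗ R`. -/
def Matrix.blockRow {ω κ ι : Type} [DecidableEq ω] (w : ω) (R : Matrix κ ι ℂ) :
    Matrix (ω × κ) ι ℂ :=
  Matrix.of fun s i => if s.1 = w then R s.2 i else 0

theorem Matrix.kronecker_mul_blockRow {ω κ ι : Type} [Fintype ω] [DecidableEq ω] [Fintype κ]
    (w : ω) (M : Matrix κ κ ℂ) (R : Matrix κ ι ℂ) :
    ((1 : Matrix ω ω ℂ) ⊗ₖ M) * blockRow w R = blockRow w (M * R) := by
  ext ⟨s, k⟩ i
  simp only [blockRow, Matrix.mul_apply, Fintype.sum_prod_type, kroneckerMap_apply, one_apply,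
    of_apply, ite_mul, one_mul, zero_mul]
  rw [Finset.sum_eq_single s (fun s' _ h => by simp [Ne.symm h]) (by simp)]
  by_cases h : s = w <;> simp [h]

theorem Matrix.conjTranspose_blockRow_mul_blockRow {ω κ ι : Type} [Fintype ω] [DecidableEq ω]
    [Fintype κ] (w w' : ω) (R S : Matrix κ ι ℂ) :
    (blockRow w R)ᴴ * blockRow w' S = if w = w' then Rᴴ * S else 0 := by
  ext i j
  simp only [blockRow, Matrix.mul_apply, Fintype.sum_prod_type, conjTranspose_apply, of_apply]
  rw [Finset.sum_eq_single w (fun s' _ h => by simp [h]) (by simp)]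
  by_cases h : w = w' <;> simp [h, Matrix.mul_apply]

/-! ### Amplification of one-way protocols -/

/-- There is a one-way protocol for `f` with completeness `α` and soundness `β`, in which Merlin
sends `a` qubits and Alice sends at most `q` qubits. -/
def HasOneWayProtocol {X Y : Type} (f : X → Y → Option Bool) (α β : ℝ) (a q : ℕ) : Prop :=
  ∃ (ι : Type) (_ : Fintype ι) (_ : DecidableEq ι) (E : X → Y → Matrix ι ι ℂ),
    Fintype.card ι = 2 ^ a ∧ IsOneWayAcceptance E q ∧ ∀ x y,
      (f x y = some true → ∃ ρ, IsState ρ ∧ (α : ℂ) ≤ (E x y * ρ).trace) ∧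
      (f x y = some false → ((β : ℂ) • (1 : Matrix ι ι ℂ) - E x y).PosSemidef)

namespace HasOneWayProtocol

variable {X Y : Type} {f : X → Y → Option Bool} {α β α' β' : ℝ} {a q a' q' : ℕ}

/-- Run two protocols in parallel and accept if both accept. -/
theorem and (hα' : 0 ≤ α') (hβ : 0 ≤ β)
    (h : HasOneWayProtocol f α β a q) (h' : HasOneWayProtocol f α' β' a' q') :
    HasOneWayProtocol f (α * α') (β * β') (a + a') (q + q') := by
  obtain ⟨ι, _, _, E, ha, hE, hf⟩ := h
  obtain ⟨ι', _, _, E', ha', hE', hf'⟩ := h'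
  refine ⟨ι × ι', inferInstance, inferInstance, _, ?_, hE.kronecker hE', fun x y => ⟨fun hxy => ?_,
    fun hxy => ?_⟩⟩
  · rw [Fintype.card_prod, ha, ha', pow_add]
  · obtain ⟨ρ, hρ, h1⟩ := (hf x y).1 hxy
    obtain ⟨ρ', hρ', h2⟩ := (hf' x y).1 hxy
    refine ⟨ρ ⊗ₖ ρ', hρ.kronecker hρ', ?_⟩
    rw [← mul_kronecker_mul, trace_kronecker, Complex.ofReal_mul]
    exact mul_le_mul h1 h2 (by exact_mod_cast hα') ((hE.isEffect x y).1.trace_mul_nonneg hρ.1)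
  -- Soundness is an operator inequality, so entangled proofs need no separate argument: `β β' - E ⊗
  -- E' = (β - E) ⊗ E' + β (1 ⊗ (β' - E'))`.
  · have h1 := (((hf x y).2 hxy).complex_kronecker (hE'.isEffect x y).1).add
      (((PosSemidef.one : (1 : Matrix ι ι ℂ).PosSemidef).complex_kronecker
        ((hf' x y).2 hxy)).smul (a := (β : ℂ)) (by exact_mod_cast hβ))
    convert h1 using 1
    rw [← one_kronecker_one]
    ext ⟨i, j⟩ ⟨i', j'⟩
    simp only [Matrix.sub_apply, Matrix.add_apply, Matrix.smul_apply, kroneckerMap_apply,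
      smul_eq_mul, Complex.ofReal_mul]
    ring

/-- Run two protocols in parallel and accept if at least one accepts. -/
theorem or (hα : α ≤ 1) (hβ : β ≤ 1)
    (h : HasOneWayProtocol f α β a q) (h' : HasOneWayProtocol f α' β' a' q') :
    HasOneWayProtocol f (1 - (1 - α) * (1 - α')) (1 - (1 - β) * (1 - β')) (a + a') (q + q') := by
  obtain ⟨ι, _, _, E, ha, hE, hf⟩ := h
  obtain ⟨ι', _, _, E', ha', hE', hf'⟩ := h'
  refine ⟨ι × ι', inferInstance, inferInstance, _, ?_, (hE.one_sub.kronecker hE'.one_sub).one_sub,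
    fun x y => ⟨fun hxy => ?_, fun hxy => ?_⟩⟩
  · rw [Fintype.card_prod, ha, ha', pow_add]
  · obtain ⟨ρ, hρ, h1⟩ := (hf x y).1 hxy
    obtain ⟨ρ', hρ', h2⟩ := (hf' x y).1 hxy
    refine ⟨ρ ⊗ₖ ρ', hρ.kronecker hρ', ?_⟩
    rw [Matrix.sub_mul, Matrix.one_mul, ← mul_kronecker_mul, trace_sub, trace_kronecker,
      trace_kronecker, Matrix.sub_mul, Matrix.sub_mul, trace_sub, trace_sub, Matrix.one_mul,
      Matrix.one_mul, hρ.2, hρ'.2]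
    push_cast
    rw [mul_one]
    refine sub_le_sub_left (mul_le_mul (sub_le_sub_left h1 1) (sub_le_sub_left h2 1)
      (sub_nonneg.2 ((hE'.isEffect x y).trace_mul_le_one hρ')) ?_) 1
    rw [sub_nonneg]
    exact_mod_cast hα
  · have h1 := (((hf x y).2 hxy).complex_kronecker (hE'.isEffect x y).2).add
      (((PosSemidef.one : (1 : Matrix ι ι ℂ).PosSemidef).complex_kronecker
        ((hf' x y).2 hxy)).smul (a := ((1 - β : ℝ) : ℂ)) (by exact_mod_cast sub_nonneg.2 hβ))
    convert h1 using 1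
    rw [← one_kronecker_one]
    ext ⟨i, j⟩ ⟨i', j'⟩
    simp only [Matrix.sub_apply, Matrix.add_apply, Matrix.smul_apply, kroneckerMap_apply,
      smul_eq_mul, Complex.ofReal_mul, Complex.ofReal_sub, Complex.ofReal_one]
    ring

theorem and_pow (hα : 0 ≤ α) (hβ : 0 ≤ β) (h : HasOneWayProtocol f α β a q) (k : ℕ) :
    HasOneWayProtocol f (α ^ (k + 1)) (β ^ (k + 1)) ((k + 1) * a) ((k + 1) * q) := by
  induction k with
  | zero => simpa using h
  | succ k ih =>
    rw [pow_succ α, pow_succ β, add_mul _ _ a, add_mul _ _ q, one_mul, one_mul]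
    exact ih.and hα (pow_nonneg hβ _) h

theorem or_pow (hα : α ≤ 1) (hβ : β ≤ 1) (h : HasOneWayProtocol f α β a q) (k : ℕ) :
    HasOneWayProtocol f (1 - (1 - α) ^ (k + 1)) (1 - (1 - β) ^ (k + 1))
      ((k + 1) * a) ((k + 1) * q) := by
  induction k with
  | zero => simpa using h
  | succ k ih =>
    rw [add_mul _ _ a, add_mul _ _ q, one_mul, one_mul]
    have := ih.or (sub_le_self _ (pow_nonneg (sub_nonneg.2 hα) _))
      (sub_le_self _ (pow_nonneg (sub_nonneg.2 hβ) _)) h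
    rwa [sub_sub_cancel, sub_sub_cancel, ← pow_succ, ← pow_succ] at this

theorem mono (hα : α' ≤ α) (hβ : β ≤ β') (h : HasOneWayProtocol f α β a q) :
    HasOneWayProtocol f α' β' a q := by
  obtain ⟨ι, _, _, E, ha, hE, hf⟩ := h
  refine ⟨ι, inferInstance, inferInstance, E, ha, hE, fun x y => ⟨fun hxy => ?_, fun hxy => ?_⟩⟩
  · obtain ⟨ρ, hρ, h1⟩ := (hf x y).1 hxy
    exact ⟨ρ, hρ, le_trans (by exact_mod_cast hα) h1⟩
  · have h1 := ((hf x y).2 hxy).add ((PosSemidef.one : (1 : Matrix ι ι ℂ).PosSemidef).smul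
      (a := ((β' - β : ℝ) : ℂ)) (by exact_mod_cast sub_nonneg.2 hβ))
    convert h1 using 1
    rw [Complex.ofReal_sub, sub_smul]
    abel

theorem oneWayQMA_le (h : HasOneWayProtocol f (2 / 3) (1 / 3) a q) :
    oneWayQMA f ≤ ((a + q : ℕ) : ℕ∞) := by
  obtain ⟨ι, _, _, E, ha, hE, hf⟩ := h
  have e : Qubits a ≃ ι := Fintype.equivOfCardEq (by simp [ha])
  have hE' := hE.submatrix e
  obtain ⟨ω, κ, _, _, _, A, B, hq, hA, hB, hAB⟩ := id hE'
  classical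
  -- Stinespring dilation: Alice keeps the Kraus index in her workspace, whose size is free.
  obtain ⟨φ⟩ : Nonempty (ω ↪ Qubits (Fintype.card ω)) := by
    refine Function.Embedding.nonempty_of_card_le ?_
    simpa using Nat.lt_two_pow_self.le
  obtain ⟨ψ⟩ : Nonempty (κ ↪ Qubits q) := by
    refine Function.Embedding.nonempty_of_card_le ?_
    simpa using hq
  let T : Matrix (Qubits q) κ ℂ := ofInjection ψ
  have hT : Tᴴ * T = 1 := ofInjection_isometry ψ.injective
  let V : X → Matrix (Qubits (Fintype.card ω) × Qubits q) (Qubits a) ℂ := fun x =>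
    Matrix.of fun s i => ∑ w, if s.1 = φ w then (T * A x w) s.2 i else 0
  have key : ∀ x (M : Matrix (Qubits q) (Qubits q) ℂ),
      (V x)ᴴ * (((1 : Matrix (Qubits (Fintype.card ω)) (Qubits (Fintype.card ω)) ℂ) ⊗ₖ M) * V x) =
        ∑ w, (T * A x w)ᴴ * M * (T * A x w) := by
    intro x M
    have hV : V x = ∑ w, blockRow (φ w) (T * A x w) := by
      ext s i
      simp [V, blockRow, Matrix.sum_apply]
    simp only [hV, conjTranspose_sum, Matrix.sum_mul, Matrix.mul_sum, kronecker_mul_blockRow,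
      conjTranspose_blockRow_mul_blockRow, φ.injective.eq_iff, Finset.sum_ite_eq', Finset.mem_univ,
      if_true, Matrix.mul_assoc]
  let P : OneWayQMAProtocol X Y :=
    { proofLen := a
      work := Fintype.card ω
      msgLen := q
      alice := V
      alice_isometry := fun x => by
        have := key x 1
        rw [one_kronecker_one, Matrix.one_mul] at this
        rw [IsIsometry, this, ← hA x]
        refine Finset.sum_congr rfl fun w _ => ?_
        rw [Matrix.mul_one, conjTranspose_mul, Matrix.mul_assoc, ← Matrix.mul_assoc Tᴴ, hT,
          Matrix.one_mul]
      bob := fun y => T * B y * Tᴴ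
      bob_effect := fun y => (hB y).conj_conjTranspose hT }
  have hP : ∀ x y ρ, P.acceptProb x y ρ = ((E x y).submatrix e e * ρ).trace.re := by
    intro x y ρ
    rw [OneWayQMAProtocol.acceptProb, ← Matrix.mul_assoc, trace_mul_comm, ← Matrix.mul_assoc,
      ← Matrix.mul_assoc]
    congr 3
    refine Eq.trans ?_ (hAB x y).symm
    rw [Matrix.mul_assoc]
    refine (key x _).trans (Finset.sum_congr rfl fun w _ => ?_)
    rw [conjTranspose_mul, show (A x w)ᴴ * Tᴴ * (T * B y * Tᴴ) * (T * A x w) =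
      (A x w)ᴴ * (Tᴴ * T) * B y * (Tᴴ * T) * A x w by simp only [Matrix.mul_assoc], hT,
      Matrix.mul_one, Matrix.mul_one]
  refine iInf₂_le_of_le P (fun x y => ⟨fun hxy => ?_, fun hxy ρ hρ => ?_⟩) le_rfl
  · obtain ⟨ρ, hρ, h1⟩ := (hf x y).1 hxy
    refine ⟨ρ.submatrix e e, hρ.submatrix e, ?_⟩
    rw [hP]
    have h2 : ((E x y).submatrix e e * ρ.submatrix e e).trace = (E x y * ρ).trace := by
      rw [submatrix_mul_equiv]
      exact Fintype.sum_equiv e _ _ fun _ => rfl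
    change _ ≤ ((E x y).submatrix e e * ρ.submatrix e e).trace.re
    rw [h2]
    exact (Complex.le_def.1 h1).1
  · rw [hP]
    have h1 := (((hf x y).2 hxy).submatrix e).trace_mul_nonneg hρ.1
    have h2 : (((1 / 3 : ℝ) : ℂ) • (1 : Matrix ι ι ℂ) - E x y).submatrix e e =
        ((1 / 3 : ℝ) : ℂ) • 1 - (E x y).submatrix e e := by
      ext i j
      simp [one_apply]
    rw [h2, Matrix.sub_mul, trace_sub, Matrix.smul_mul, trace_smul, Matrix.one_mul, hρ.2,
      sub_nonneg, smul_eq_mul, mul_one] at h1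
    exact (Complex.le_def.1 h1).1

end HasOneWayProtocol

theorem exists_amplification {α β : ℝ} (hβ : 0 ≤ β) (hαβ : β < α) (hα : α ≤ 1) :
    ∃ k l : ℕ, 2 / 3 ≤ 1 - (1 - α ^ (k + 1)) ^ (l + 1) ∧
      1 - (1 - β ^ (k + 1)) ^ (l + 1) ≤ 1 / 3 := by
  have hα0 : 0 < α := hβ.trans_lt hαβ
  -- The AND makes the ratio of the two probabilities at most 1/12. An OR of about `2 / A` copies
  -- then has completeness at least `1 - exp (-2)`, and by the union bound soundness at most `3 /
  -- 12`.
  obtain ⟨k, hk⟩ := exists_pow_lt_of_lt_one (show (0 : ℝ) < 1 / 12 by norm_num)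
    ((div_lt_one hα0).2 hαβ)
  have hk' : (β / α) ^ (k + 1) ≤ 1 / 12 :=
    (pow_le_pow_of_le_one (div_nonneg hβ hα0.le) ((div_lt_one hα0).2 hαβ).le k.le_succ).trans hk.le
  set A := α ^ (k + 1) with hA
  set B := β ^ (k + 1) with hB
  have hA0 : 0 < A := pow_pos hα0 _
  have hA1 : A ≤ 1 := pow_le_one₀ hα0.le hα
  have hB0 : 0 ≤ B := pow_nonneg hβ _
  have hBA : B ≤ A / 12 := by
    rw [div_pow, div_le_iff₀ hA0] at hk'
    linarith
  obtain ⟨l, hl⟩ : ∃ l : ℕ, l = ⌊2 / A⌋₊ := ⟨_, rfl⟩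
  have hl1 : 2 / A ≤ (l : ℝ) + 1 := hl ▸ (Nat.lt_floor_add_one _).le
  have hl2 : (l : ℝ) ≤ 2 / A := hl ▸ Nat.floor_le (by positivity)
  rw [div_le_iff₀ hA0] at hl1
  rw [le_div_iff₀ hA0] at hl2
  refine ⟨k, l, ?_, ?_⟩
  · have h1 : (1 - A) ^ (l + 1) ≤ Real.exp (-A) ^ (l + 1) :=
      pow_le_pow_left₀ (by linarith) (Real.one_sub_le_exp_neg A) _
    rw [← Real.exp_nat_mul] at h1
    have h2 : Real.exp (((l + 1 : ℕ) : ℝ) * -A) ≤ Real.exp (-2) := by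
      refine Real.exp_le_exp.2 ?_
      push_cast
      linarith
    have h3 : Real.exp (-2) ≤ 1 / 3 := by
      rw [Real.exp_neg, one_div]
      refine inv_anti₀ (by norm_num) ?_
      have := Real.add_one_le_exp (2 : ℝ)
      linarith
    linarith
  · have h1 := one_add_mul_le_pow (a := -B) (by linarith) (l + 1)
    push_cast at h1
    rw [← sub_eq_add_neg] at h1
    nlinarith

theorem HasOneWayProtocol.exists_amplification {α β : ℝ} (hβ : 0 ≤ β) (hαβ : β < α) (hα : α ≤ 1) :
    ∃ N : ℕ, ∀ {X Y : Type} (f : X → Y → Option Bool) (a q : ℕ), HasOneWayProtocol f α β a q →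
      oneWayQMA f ≤ ((N * (a + q) : ℕ) : ℕ∞) := by
  obtain ⟨k, l, h1, h2⟩ := _root_.exists_amplification hβ hαβ hα
  refine ⟨(l + 1) * (k + 1), fun f a q h => ?_⟩
  have hα0 := hβ.trans hαβ.le
  have := (((h.and_pow hα0 hβ k).or_pow (pow_le_one₀ hα0 hα)
    (pow_le_one₀ hβ (hαβ.le.trans hα)) l).mono h1 h2).oneWayQMA_le
  rwa [← mul_assoc, ← mul_assoc, ← mul_add] at this

/-! ### Quadratic forms and squared norms -/

/-- The real quadratic form of a matrix. -/
noncomputable def quadForm {ι : Type} [Fintype ι] (M : Matrix ι ι ℂ) (v : ι → ℂ) : ℝ :=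
  (star v ⬝ᵥ (M *ᵥ v)).re

/-- The squared norm of a vector. -/
noncomputable def normSqVec {ι : Type} [Fintype ι] (v : ι → ℂ) : ℝ :=
  ∑ i, Complex.normSq (v i)

section QuadForm

variable {ι κ : Type} [Fintype ι] [Fintype κ]

theorem normSqVec_nonneg (v : ι → ℂ) : 0 ≤ normSqVec v :=
  Finset.sum_nonneg fun _ _ => Complex.normSq_nonneg _

theorem quadForm_conjTranspose_mul (A : Matrix κ ι ℂ) (v : ι → ℂ) :
    quadForm (Aᴴ * A) v = normSqVec (A *ᵥ v) := by
  rw [quadForm, ← mulVec_mulVec, dotProduct_mulVec, ← star_mulVec, dotProduct, Complex.re_sum]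
  refine Finset.sum_congr rfl fun i _ => ?_
  simp [Complex.normSq_apply]

theorem quadForm_conj (M : Matrix κ κ ℂ) (A : Matrix κ ι ℂ) (v : ι → ℂ) :
    quadForm (Aᴴ * M * A) v = quadForm M (A *ᵥ v) := by
  rw [quadForm, ← mulVec_mulVec, ← mulVec_mulVec, dotProduct_mulVec, ← star_mulVec, quadForm]

theorem quadForm_one [DecidableEq ι] (v : ι → ℂ) : quadForm 1 v = normSqVec v := by
  have := quadForm_conjTranspose_mul (1 : Matrix ι ι ℂ) v
  simpa using this

theorem quadForm_add (M N : Matrix ι ι ℂ) (v : ι → ℂ) :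
    quadForm (M + N) v = quadForm M v + quadForm N v := by
  simp [quadForm, add_mulVec, dotProduct_add]

theorem quadForm_sub (M N : Matrix ι ι ℂ) (v : ι → ℂ) :
    quadForm (M - N) v = quadForm M v - quadForm N v := by
  simp [quadForm, sub_mulVec, dotProduct_sub]

theorem quadForm_smul (c : ℝ) (M : Matrix ι ι ℂ) (v : ι → ℂ) :
    quadForm ((c : ℂ) • M) v = c * quadForm M v := by
  simp [quadForm, smul_mulVec, dotProduct_smul]

theorem quadForm_sum {τ : Type} (s : Finset τ) (M : τ → Matrix ι ι ℂ) (v : ι → ℂ) :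
    quadForm (∑ t ∈ s, M t) v = ∑ t ∈ s, quadForm (M t) v := by
  simp [quadForm, Matrix.sum_mulVec, dotProduct_sum]

theorem Matrix.PosSemidef.quadForm_nonneg {M : Matrix ι ι ℂ} (h : M.PosSemidef) (v : ι → ℂ) :
    0 ≤ quadForm M v :=
  (Complex.le_def.1 (h.dotProduct_mulVec_nonneg v)).1

theorem Matrix.IsHermitian.posSemidef_of_quadForm {M : Matrix ι ι ℂ} (h : M.IsHermitian)
    (h0 : ∀ v, 0 ≤ quadForm M v) : M.PosSemidef := by
  refine PosSemidef.of_dotProduct_mulVec_nonneg h fun v => Complex.le_def.2 ⟨h0 v, ?_⟩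
  exact (h.im_star_dotProduct_mulVec_self v).symm

theorem normSqVec_mulVec_of_isometry [DecidableEq ι] {V : Matrix κ ι ℂ} (hV : Vᴴ * V = 1)
    (v : ι → ℂ) : normSqVec (V *ᵥ v) = normSqVec v := by
  rw [← quadForm_conjTranspose_mul, hV, quadForm_one]

theorem normSqVec_add_le (v w : ι → ℂ) :
    normSqVec (v + w) ≤ 2 * normSqVec v + 2 * normSqVec w := by
  simp only [normSqVec, Finset.mul_sum, ← Finset.sum_add_distrib]
  refine Finset.sum_le_sum fun i _ => ?_
  simp only [Pi.add_apply, Complex.normSq_apply, Complex.add_re, Complex.add_im]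
  nlinarith [sq_nonneg ((v i).re - (w i).re), sq_nonneg ((v i).im - (w i).im)]

/-- Young's inequality, with a factor close to 1 on the main term: the factor 2 of
`normSqVec_add_le` would destroy the gap between 1/3 and 2/3. -/
theorem normSqVec_add_le' (v w : ι → ℂ) :
    normSqVec (v + w) ≤ 11 / 10 * normSqVec v + 11 * normSqVec w := by
  simp only [normSqVec, Finset.mul_sum, ← Finset.sum_add_distrib]
  refine Finset.sum_le_sum fun i _ => ?_
  simp only [Pi.add_apply, Complex.normSq_apply, Complex.add_re, Complex.add_im]
  nlinarith [sq_nonneg ((v i).re - 10 * (w i).re), sq_nonneg ((v i).im - 10 * (w i).im)]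

theorem le_normSqVec_add (v w : ι → ℂ) :
    9 / 10 * normSqVec v - 10 * normSqVec w ≤ normSqVec (v + w) := by
  simp only [normSqVec, Finset.mul_sum, ← Finset.sum_sub_distrib]
  refine Finset.sum_le_sum fun i _ => ?_
  simp only [Pi.add_apply, Complex.normSq_apply, Complex.add_re, Complex.add_im]
  nlinarith [sq_nonneg ((v i).re + 10 * (w i).re), sq_nonneg ((v i).im + 10 * (w i).im),
    sq_nonneg (w i).re, sq_nonneg (w i).im]

theorem normSqVec_neg (v : ι → ℂ) : normSqVec (-v) = normSqVec v := by
  simp [normSqVec]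

theorem Matrix.PosSemidef.le_quadForm_add [DecidableEq ι] {Z : Matrix ι ι ℂ} (hZ : Z.PosSemidef)
    (v w : ι → ℂ) : 9 / 10 * quadForm Z v - 10 * quadForm Z w ≤ quadForm Z (v + w) := by
  obtain ⟨C, rfl⟩ := hZ.exists_eq_conjTranspose_mul
  simp only [quadForm_conjTranspose_mul, mulVec_add]
  exact le_normSqVec_add _ _

theorem IsEffect.quadForm_le [DecidableEq ι] {Z : Matrix ι ι ℂ} (hZ : IsEffect Z) (v : ι → ℂ) :
    quadForm Z v ≤ normSqVec v := by
  have := hZ.2.quadForm_nonneg v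
  rw [quadForm_sub, quadForm_one] at this
  linarith

end QuadForm

/-! ### History states and their penalty -/

namespace HistoryState

variable {R : ℕ} {S : ℕ → Type} [∀ t, Fintype (S t)] [∀ t, DecidableEq (S t)]
  {H : Type} [Fintype H] [DecidableEq H]

/-- The evolution from time `0` to time `t`. -/
def evolution (K : (t : ℕ) → Matrix (S (t + 1)) (S t) ℂ) : (t : ℕ) → Matrix (S t) (S 0) ℂ
  | 0 => 1
  | t + 1 => K t * evolution K t

/-- The spaces at the times `0, …, R` are embedded as orthogonal subspaces. -/
structure IsFrame (R : ℕ) (J : (t : ℕ) → Matrix H (S t) ℂ) : Prop where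
  isometry : ∀ t ≤ R, (J t)ᴴ * J t = 1
  orthogonal : ∀ s ≤ R, ∀ t ≤ R, s ≠ t → (J s)ᴴ * J t = 0

variable (J : (t : ℕ) → Matrix H (S t) ℂ) (K : (t : ℕ) → Matrix (S (t + 1)) (S t) ℂ)
  (Z : Matrix (S R) (S R) ℂ)

/-- The defect of a history between the times `t` and `t + 1`. -/
def defect (t : ℕ) : Matrix (S (t + 1)) H ℂ :=
  (J (t + 1))ᴴ - K t * (J t)ᴴ

/-- The projection onto the span of the spaces at the times `0, …, R`. -/
def proj (R : ℕ) : Matrix H H ℂ :=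
  ∑ t ∈ Finset.range (R + 1), J t * (J t)ᴴ

/-- The penalty for violating the propagation at the times in `s`, and, with weight `δ`, for
the rejection `Z` at time `R`. -/
noncomputable def penalty (s : Finset ℕ) (δ : ℝ) : Matrix H H ℂ :=
  (1 - proj J R) + ∑ t ∈ s, (defect J K t)ᴴ * defect J K t + (δ : ℂ) • (J R * Z * (J R)ᴴ)

variable {J K Z}

theorem IsFrame.proj_mul (hJ : IsFrame R J) {t : ℕ} (ht : t ≤ R) : proj J R * J t = J t := by
  rw [proj, Matrix.sum_mul, Finset.sum_eq_single t]
  · rw [Matrix.mul_assoc, hJ.isometry t ht, Matrix.mul_one]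
  · intro s hs hst
    rw [Matrix.mul_assoc, hJ.orthogonal s (Nat.lt_succ_iff.1 (Finset.mem_range.1 hs)) t ht hst,
      Matrix.mul_zero]
  · exact fun h => (h (Finset.mem_range.2 (Nat.lt_succ_iff.2 ht))).elim

theorem proj_isHermitian : (proj J R).IsHermitian := by
  simp [IsHermitian, proj, conjTranspose_sum]

theorem IsFrame.one_sub_proj_posSemidef (hJ : IsFrame R J) : (1 - proj J R).PosSemidef := by
  have h1 : proj J R * proj J R = proj J R := by
    conv_lhs => enter [2]; rw [proj]
    rw [Matrix.mul_sum]
    refine Finset.sum_congr rfl fun t ht => ?_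
    rw [← Matrix.mul_assoc, hJ.proj_mul (Nat.lt_succ_iff.1 (Finset.mem_range.1 ht))]
  have h2 : 1 - proj J R = (1 - proj J R)ᴴ * (1 - proj J R) := by
    rw [conjTranspose_sub, proj_isHermitian.eq, conjTranspose_one]
    simp [Matrix.mul_sub, Matrix.sub_mul, h1]
  rw [h2]
  exact posSemidef_conjTranspose_mul_self _

theorem quadForm_proj (v : H → ℂ) :
    quadForm (proj J R) v = ∑ t ∈ Finset.range (R + 1), normSqVec ((J t)ᴴ *ᵥ v) := by
  rw [proj, quadForm_sum]
  refine Finset.sum_congr rfl fun t _ => ?_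
  rw [← quadForm_conjTranspose_mul, conjTranspose_conjTranspose]

theorem IsFrame.quadForm_proj_le (hJ : IsFrame R J) (v : H → ℂ) :
    quadForm (proj J R) v ≤ normSqVec v := by
  have := hJ.one_sub_proj_posSemidef.quadForm_nonneg v
  rw [quadForm_sub, quadForm_one] at this
  linarith

theorem IsFrame.normSqVec_le (hJ : IsFrame R J) {t : ℕ} (ht : t ≤ R) (v : H → ℂ) :
    normSqVec ((J t)ᴴ *ᵥ v) ≤ normSqVec v := by
  refine le_trans ?_ (hJ.quadForm_proj_le v)
  rw [quadForm_proj]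
  exact Finset.single_le_sum (f := fun t => normSqVec ((J t)ᴴ *ᵥ v))
    (fun _ _ => normSqVec_nonneg _) (Finset.mem_range.2 (Nat.lt_succ_iff.2 ht))

theorem quadForm_penalty (s : Finset ℕ) (δ : ℝ) (v : H → ℂ) :
    quadForm (penalty J K Z s δ) v = (normSqVec v - quadForm (proj J R) v) +
      ∑ t ∈ s, normSqVec (defect J K t *ᵥ v) + δ * quadForm Z ((J R)ᴴ *ᵥ v) := by
  rw [penalty, quadForm_add, quadForm_add, quadForm_sub, quadForm_one, quadForm_sum, quadForm_smul,
    ← quadForm_conj, conjTranspose_conjTranspose]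
  simp only [quadForm_conjTranspose_mul]

theorem penalty_posSemidef (hJ : IsFrame R J) (hZ : IsEffect Z) (s : Finset ℕ) {δ : ℝ}
    (hδ : 0 ≤ δ) : (penalty J K Z s δ).PosSemidef :=
  (hJ.one_sub_proj_posSemidef.add (posSemidef_sum _ fun _ _ =>
    posSemidef_conjTranspose_mul_self _)).add
    ((hZ.1.mul_mul_conjTranspose_same (J R)).smul (by exact_mod_cast hδ))

/-- The constant adds up 1 for leaving the frame, 4 for each of at most R defects, and 1 for the
rejection. -/
theorem quadForm_penalty_le (hJ : IsFrame R J) (hK : ∀ t < R, (K t)ᴴ * K t = 1)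
    (hZ : IsEffect Z) {s : Finset ℕ} (hs : s ⊆ Finset.range R) {δ : ℝ} (hδ1 : δ ≤ 1)
    (v : H → ℂ) : quadForm (penalty J K Z s δ) v ≤ (4 * R + 2) * normSqVec v := by
  have h1 : ∀ t ∈ s, normSqVec (defect J K t *ᵥ v) ≤ 4 * normSqVec v := by
    intro t ht
    have ht := Finset.mem_range.1 (hs ht)
    rw [defect, sub_mulVec, sub_eq_add_neg, ← mulVec_mulVec]
    refine (normSqVec_add_le _ _).trans ?_
    rw [normSqVec_neg, normSqVec_mulVec_of_isometry (hK t ht)]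
    linarith [hJ.normSqVec_le ht v, hJ.normSqVec_le ht.le v]
  have h2 := (Finset.sum_le_card_nsmul s _ _ h1)
  have h3 : (s.card : ℝ) ≤ R := by
    exact_mod_cast (Finset.card_le_card hs).trans (Finset.card_range R).le
  have h4 := normSqVec_nonneg v
  have h5 : δ * quadForm Z ((J R)ᴴ *ᵥ v) ≤ normSqVec v :=
    (mul_le_mul hδ1 ((hZ.quadForm_le _).trans (hJ.normSqVec_le le_rfl v)) (hZ.1.quadForm_nonneg _)
      zero_le_one).trans (one_mul _).le
  have h6 : 0 ≤ quadForm (proj J R) v := by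
    rw [quadForm_proj]
    exact Finset.sum_nonneg fun _ _ => normSqVec_nonneg _
  rw [quadForm_penalty]
  rw [nsmul_eq_mul] at h2
  nlinarith

/-- The effect that accepts the histories without penalty. -/
theorem one_sub_penalty_isEffect (hJ : IsFrame R J) (hK : ∀ t < R, (K t)ᴴ * K t = 1)
    (hZ : IsEffect Z) {s : Finset ℕ} (hs : s ⊆ Finset.range R) {δ : ℝ} (hδ : 0 ≤ δ)
    (hδ1 : δ ≤ 1) : IsEffect (1 - ((1 / (4 * R + 2) : ℝ) : ℂ) • penalty J K Z s δ) := by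
  have h1 : (((1 / (4 * R + 2) : ℝ) : ℂ) • penalty J K Z s δ).PosSemidef :=
    (penalty_posSemidef hJ hZ s hδ).smul (by exact_mod_cast (by positivity))
  refine ⟨(isHermitian_one.sub h1.1).posSemidef_of_quadForm fun v => ?_, by simpa using h1⟩
  rw [quadForm_sub, quadForm_one, quadForm_smul, sub_nonneg, one_div,
    inv_mul_le_iff₀ (by positivity)]
  exact quadForm_penalty_le hJ hK hZ hs hδ1 v

theorem evolution_isometry (hK : ∀ t < R, (K t)ᴴ * K t = 1) {t : ℕ} (ht : t ≤ R) :
    (evolution K t)ᴴ * evolution K t = 1 := by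
  induction t with
  | zero => simp [evolution]
  | succ t ih =>
    rw [evolution, conjTranspose_mul, Matrix.mul_assoc, ← Matrix.mul_assoc (K t)ᴴ, hK t ht,
      Matrix.one_mul, ih (Nat.le_of_succ_le ht)]

/-- A history deviates from the evolution of its initial part by at most the sum of its defects. -/
theorem normSqVec_sub_evolution_le (hK : ∀ t < R, (K t)ᴴ * K t = 1) (v : H → ℂ) {t : ℕ}
    (ht : t ≤ R) : normSqVec ((J t)ᴴ *ᵥ v - evolution K t *ᵥ ((J 0)ᴴ *ᵥ v)) ≤
      2 ^ t * ∑ s ∈ Finset.range t, normSqVec (defect J K s *ᵥ v) := by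
  induction t with
  | zero => simp [evolution, normSqVec]
  | succ t ih =>
    have h1 : (J (t + 1))ᴴ *ᵥ v - evolution K (t + 1) *ᵥ ((J 0)ᴴ *ᵥ v) =
        defect J K t *ᵥ v + K t *ᵥ ((J t)ᴴ *ᵥ v - evolution K t *ᵥ ((J 0)ᴴ *ᵥ v)) := by
      simp only [defect, evolution, sub_mulVec, mulVec_sub, mulVec_mulVec, Matrix.mul_assoc]
      abel
    rw [h1]
    refine (normSqVec_add_le _ _).trans ?_
    rw [normSqVec_mulVec_of_isometry (hK t ht), Finset.sum_range_succ, pow_succ]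
    have h2 := ih (Nat.le_of_succ_le ht)
    have h3 := normSqVec_nonneg (defect J K t *ᵥ v)
    have h4 : (1 : ℝ) ≤ 2 ^ t := one_le_pow₀ (by norm_num)
    nlinarith

/-- If the total defect `D` is small, every component of `v` is close to the evolution of the
initial one, `u`. So the frame part of `v` has squared norm about `(R + 1) * normSqVec u`, while the
end pays nearly 2/3 of `normSqVec u`. The term outside the frame is doubled because both players
charge it. -/
theorem le_quadForm_penalty (hJ : IsFrame R J) (hK : ∀ t < R, (K t)ᴴ * K t = 1)
    (hZ : IsEffect Z)
    (hZ' : ∀ u, 2 / 3 * normSqVec u ≤ quadForm Z (evolution K R *ᵥ u)) (v : H → ℂ) :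
    1 / (16 * 2 ^ R) / (2 * (R + 1)) * normSqVec v ≤
      2 * (normSqVec v - quadForm (proj J R) v) +
      ∑ t ∈ Finset.range R, normSqVec (defect J K t *ᵥ v) +
      1 / (16 * 2 ^ R) * quadForm Z ((J R)ᴴ *ᵥ v) := by
  set u := (J 0)ᴴ *ᵥ v with hu
  set D := ∑ t ∈ Finset.range R, normSqVec (defect J K t *ᵥ v) with hD
  set n := normSqVec u with hn
  have hD0 : 0 ≤ D := Finset.sum_nonneg fun _ _ => normSqVec_nonneg _
  have hdev : ∀ t ≤ R, normSqVec ((J t)ᴴ *ᵥ v - evolution K t *ᵥ u) ≤ 2 ^ R * D := by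
    intro t ht
    refine (normSqVec_sub_evolution_le hK v ht).trans ?_
    refine mul_le_mul (pow_le_pow_right₀ (by norm_num) ht) ?_
      (Finset.sum_nonneg fun _ _ => normSqVec_nonneg _) (by positivity)
    exact Finset.sum_le_sum_of_subset_of_nonneg (Finset.range_mono ht)
      fun _ _ _ => normSqVec_nonneg _
  have hproj : quadForm (proj J R) v ≤ (R + 1) * (11 / 10 * n + 11 * (2 ^ R * D)) := by
    rw [quadForm_proj]
    have : ∀ t ∈ Finset.range (R + 1), normSqVec ((J t)ᴴ *ᵥ v) ≤
        11 / 10 * n + 11 * (2 ^ R * D) := by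
      intro t ht
      have ht := Nat.lt_succ_iff.1 (Finset.mem_range.1 ht)
      have h1 := normSqVec_add_le' (evolution K t *ᵥ u) ((J t)ᴴ *ᵥ v - evolution K t *ᵥ u)
      rw [add_sub_cancel, normSqVec_mulVec_of_isometry (evolution_isometry hK ht)] at h1
      linarith [hdev t ht]
    refine (Finset.sum_le_card_nsmul _ _ _ this).trans (le_of_eq ?_)
    rw [Finset.card_range, nsmul_eq_mul, Nat.cast_add, Nat.cast_one]
  have hend : 6 / 10 * n - 10 * (2 ^ R * D) ≤ quadForm Z ((J R)ᴴ *ᵥ v) := by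
    have h1 := hZ.1.le_quadForm_add (evolution K R *ᵥ u) ((J R)ᴴ *ᵥ v - evolution K R *ᵥ u)
    rw [add_sub_cancel] at h1
    linarith [hZ' u, (hZ.quadForm_le ((J R)ᴴ *ᵥ v - evolution K R *ᵥ u)).trans (hdev R le_rfl)]
  set p := quadForm (proj J R) v
  have hp := hJ.quadForm_proj_le v
  have hB : (1 : ℝ) ≤ 2 ^ R := one_le_pow₀ (by norm_num)
  have hn0 : 0 ≤ n := normSqVec_nonneg _
  generalize (2 : ℝ) ^ R = B at *
  have hR : (0 : ℝ) < R + 1 := by positivity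
  set w := 1 / (16 * B) with hw
  have hw0 : 0 < w := by positivity
  have hwB : w * B = 1 / 16 := by rw [hw]; field_simp
  have hw1 : w ≤ 1 := by nlinarith
  have hc : w / (2 * (R + 1)) ≤ 2 := by
    rw [div_le_iff₀ (by positivity)]
    nlinarith [(Nat.cast_nonneg R : (0 : ℝ) ≤ R)]
  have h1 : w / (2 * (R + 1)) * p ≤ w / 2 * (11 / 10 * n + 11 * (B * D)) := by
    refine (mul_le_mul_of_nonneg_left hproj (by positivity)).trans (le_of_eq ?_)
    field_simp
  have h2 : w / (2 * (R + 1)) * (normSqVec v - p) ≤ 2 * (normSqVec v - p) :=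
    mul_le_mul_of_nonneg_right hc (by linarith)
  have h3 := mul_le_mul_of_nonneg_left hend hw0.le
  have h4 : w * (B * D) = 1 / 16 * D := by rw [← mul_assoc, hwB]
  -- Since `w * B = 1 / 16`, the losses in `D` are `10 / 16 + 11 / 32 < 1`, covered by the defect
  -- term. In `n`, the gain `6 / 10 * w` exceeds the required `11 / 20 * w`.
  nlinarith [mul_nonneg hw0.le hn0]

/-- The superposition of the states at the times `0, …, R`. -/
def history (R : ℕ) (J : (t : ℕ) → Matrix H (S t) ℂ)
    (K : (t : ℕ) → Matrix (S (t + 1)) (S t) ℂ) : Matrix H (S 0) ℂ :=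
  ∑ t ∈ Finset.range (R + 1), J t * evolution K t

theorem IsFrame.conjTranspose_mul_history (hJ : IsFrame R J) {t : ℕ} (ht : t ≤ R) :
    (J t)ᴴ * history R J K = evolution K t := by
  rw [history, Matrix.mul_sum, Finset.sum_eq_single t]
  · rw [← Matrix.mul_assoc, hJ.isometry t ht, Matrix.one_mul]
  · intro s hs hst
    rw [← Matrix.mul_assoc, hJ.orthogonal t ht s (Nat.lt_succ_iff.1 (Finset.mem_range.1 hs))
      hst.symm, Matrix.zero_mul]
  · exact fun h => (h (Finset.mem_range.2 (Nat.lt_succ_iff.2 ht))).elim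

theorem IsFrame.history_conjTranspose_mul (hJ : IsFrame R J) (hK : ∀ t < R, (K t)ᴴ * K t = 1) :
    (history R J K)ᴴ * history R J K = ((R : ℂ) + 1) • 1 := by
  conv_lhs => enter [1]; rw [history]
  rw [conjTranspose_sum, Matrix.sum_mul]
  rw [Finset.sum_congr rfl (g := fun _ => 1)]
  · simp [← Nat.cast_smul_eq_nsmul ℂ]
  · intro t ht
    have ht := Nat.lt_succ_iff.1 (Finset.mem_range.1 ht)
    rw [conjTranspose_mul, Matrix.mul_assoc, hJ.conjTranspose_mul_history ht,
      evolution_isometry hK ht]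

/-- A history lies in the frame and has no defects, so only the rejection term survives. -/
theorem IsFrame.penalty_history (hJ : IsFrame R J) {s : Finset ℕ} (hs : s ⊆ Finset.range R)
    (δ : ℝ) : (history R J K)ᴴ * penalty J K Z s δ * history R J K =
      (δ : ℂ) • ((evolution K R)ᴴ * Z * evolution K R) := by
  have h1 : proj J R * history R J K = history R J K := by
    conv_lhs => rw [history, Matrix.mul_sum]
    refine Finset.sum_congr rfl fun t ht => ?_
    rw [← Matrix.mul_assoc, hJ.proj_mul (Nat.lt_succ_iff.1 (Finset.mem_range.1 ht))]
  have h2 : ∀ t ∈ s, (defect J K t)ᴴ * defect J K t * history R J K = 0 := by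
    intro t ht
    have ht := Finset.mem_range.1 (hs ht)
    rw [Matrix.mul_assoc]
    conv_lhs => enter [2]; rw [defect]
    rw [Matrix.sub_mul, Matrix.mul_assoc (K t), hJ.conjTranspose_mul_history ht,
      hJ.conjTranspose_mul_history ht.le, evolution, sub_self, Matrix.mul_zero]
  have h3 : (history R J K)ᴴ * J R = (evolution K R)ᴴ := by
    rw [← hJ.conjTranspose_mul_history le_rfl, conjTranspose_mul, conjTranspose_conjTranspose]
  rw [Matrix.mul_assoc, penalty, Matrix.add_mul, Matrix.add_mul, Matrix.sub_mul, h1,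
    Matrix.one_mul, sub_self, Matrix.sum_mul, Finset.sum_eq_zero h2, add_zero, zero_add,
    Matrix.smul_mul, Matrix.mul_smul, Matrix.mul_assoc, hJ.conjTranspose_mul_history le_rfl,
    ← Matrix.mul_assoc, ← Matrix.mul_assoc, h3]

end HistoryState

/-! ### The one-way protocol that checks a history -/

namespace HistoryState

variable {R : ℕ} {S : ℕ → Type} [∀ t, Fintype (S t)] [∀ t, DecidableEq (S t)]
  {H : Type} [Fintype H] [DecidableEq H]

/-- The disjoint union of the bases is injected into the basis of `H`; the summand plays the role of
the clock. -/
theorem exists_isFrame (R : ℕ) (h : ∑ t : Fin (R + 1), Fintype.card (S t) ≤ Fintype.card H) :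
    ∃ J : (t : ℕ) → Matrix H (S t) ℂ, IsFrame R J := by
  obtain ⟨φ⟩ : Nonempty ((Σ t : Fin (R + 1), S t) ↪ H) := by
    refine Function.Embedding.nonempty_of_card_le ?_
    rwa [Fintype.card_sigma]
  let J : (t : ℕ) → Matrix H (S t) ℂ := fun t =>
    if h : t < R + 1 then ofInjection fun s : S t => φ ⟨⟨t, h⟩, s⟩ else 0
  have hJ : ∀ t (h : t ≤ R), J t = ofInjection fun s : S t => φ ⟨⟨t, Nat.lt_succ_iff.2 h⟩, s⟩ :=
    fun t h => dif_pos (Nat.lt_succ_iff.2 h)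
  refine ⟨J, fun t ht => ?_, fun s hs t ht hst => ?_⟩
  · rw [hJ t ht]
    refine ofInjection_isometry fun a b hab => ?_
    simpa using φ.injective hab
  · rw [hJ t ht, hJ s hs]
    ext i j
    simp only [ofInjection, mul_apply, conjTranspose_apply, of_apply, Matrix.zero_apply]
    refine Finset.sum_eq_zero fun k _ => ?_
    by_cases h1 : k = φ ⟨⟨s, Nat.lt_succ_iff.2 hs⟩, i⟩
    · rw [if_neg (c := k = φ ⟨⟨t, _⟩, j⟩), mul_zero]
      intro h2
      have := congrArg Sigma.fst (φ.injective (h1.symm.trans h2))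
      exact hst (congrArg Fin.val this)
    · simp [h1]

/-- Locality: with `s` the times of one player, and `δ = 0` unless that player gives the output, the
penalty is a function of that player's input alone. -/
theorem penalty_congr {J : (t : ℕ) → Matrix H (S t) ℂ}
    {K K' : (t : ℕ) → Matrix (S (t + 1)) (S t) ℂ} {Z Z' : Matrix (S R) (S R) ℂ} {s : Finset ℕ}
    {δ : ℝ} (hK : ∀ t ∈ s, K t = K' t) (hZ : δ ≠ 0 → Z = Z') :
    penalty J K Z s δ = penalty J K' Z' s δ := by
  rw [penalty, penalty]
  congr 1
  · congr 1
    refine Finset.sum_congr rfl fun t ht => ?_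
    rw [defect, defect, hK t ht]
  · by_cases h : δ = 0
    · simp [h]
    · rw [hZ h]

/-- Alternating isometries of the two players, followed by a measurement with rejecting effect `Z`,
can be verified by a one-way protocol in which Merlin sends the history of the computation. -/
theorem hasOneWayProtocol {X Y : Type} [Nonempty X] [Nonempty Y] (f : X → Y → Option Bool)
    (turn : ℕ → Player) (K : X → Y → (t : ℕ) → Matrix (S (t + 1)) (S t) ℂ)
    (Z : X → Y → Matrix (S R) (S R) ℂ)
    (hKA : ∀ t < R, turn t = .alice → ∀ x y y', K x y t = K x y' t)
    (hKB : ∀ t < R, turn t = .bob → ∀ x x' y, K x y t = K x' y t)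
    (hZA : turn R = .alice → ∀ x y y', Z x y = Z x y')
    (hZB : turn R = .bob → ∀ x x' y, Z x y = Z x' y)
    (hK : ∀ x y, ∀ t < R, (K x y t)ᴴ * K x y t = 1) (hZ : ∀ x y, IsEffect (Z x y))
    {k : ℕ} (hk : ∑ t : Fin (R + 1), Fintype.card (S t) ≤ 2 ^ k)
    (hyes : ∀ x y, f x y = some true → ∃ ρ, IsState ρ ∧
      ((evolution (K x y) R)ᴴ * Z x y * evolution (K x y) R * ρ).trace ≤ ((1 / 3 : ℝ) : ℂ))
    (hno : ∀ x y, f x y = some false →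
      ∀ u, 2 / 3 * normSqVec u ≤ quadForm (Z x y) (evolution (K x y) R *ᵥ u)) :
    HasOneWayProtocol f (1 - 1 / (4 * R + 2) * (1 / (16 * 2 ^ R)) / (6 * (R + 1)))
      (1 - 1 / (4 * R + 2) * (1 / (16 * 2 ^ R)) / (4 * (R + 1))) k (k + 2) := by
  classical
  obtain ⟨J, hJ⟩ := exists_isFrame (S := S) (H := Qubits k) R (by simpa using hk)
  -- Dummy values for the opponent's input, on which a player's penalty does not depend.
  obtain ⟨x₀⟩ := ‹Nonempty X›
  obtain ⟨y₀⟩ := ‹Nonempty Y›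
  set κ : ℝ := 1 / (4 * R + 2) with hκ
  set w : ℝ := 1 / (16 * 2 ^ R) with hw
  have hκ0 : 0 < κ := by positivity
  have hw0 : 0 < w := by positivity
  have hw1 : w ≤ 1 := by
    rw [hw, div_le_one (by positivity)]
    have : (1 : ℝ) ≤ 2 ^ R := one_le_pow₀ (by norm_num)
    linarith
  let s : Player → Finset ℕ := fun p => (Finset.range R).filter fun t => turn t = p
  let δ : Player → ℝ := fun p => if turn R = p then w else 0
  have hs : ∀ p, s p ⊆ Finset.range R := fun p => Finset.filter_subset _ _
  have hδ0 : ∀ p, 0 ≤ δ p := fun p => by dsimp only [δ]; split_ifs <;> linarith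
  have hδ1 : ∀ p, δ p ≤ 1 := fun p => by dsimp only [δ]; split_ifs <;> linarith
  let pen : X → Y → Player → Matrix (Qubits k) (Qubits k) ℂ := fun x y p =>
    penalty J (K x y) (Z x y) (s p) (δ p)
  have hmem : ∀ {p t}, t ∈ s p → t < R ∧ turn t = p := fun h => by simpa [s] using h
  have hδp : ∀ {p}, δ p ≠ 0 → turn R = p := fun {p} h => by
    by_contra h'
    exact h (if_neg h')
  have hpenA : ∀ x y, pen x y .alice = pen x y₀ .alice := fun x y => penalty_congr
    (fun t ht => hKA t (hmem ht).1 (hmem ht).2 _ _ _) fun h => hZA (hδp h) _ _ _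
  have hpenB : ∀ x y, pen x y .bob = pen x₀ y .bob := fun x y => penalty_congr
    (fun t ht => hKB t (hmem ht).1 (hmem ht).2 _ _ _) fun h => hZB (hδp h) _ _ _
  have heff : ∀ x y p, IsEffect (1 - (κ : ℂ) • pen x y p) := fun x y p =>
    one_sub_penalty_isEffect hJ (hK x y) (hZ x y) (hs p) (hδ0 p) (hδ1 p)
  have hmix := IsOneWayAcceptance.mix (fun x => heff x y₀ .alice) (fun y => heff x₀ y .bob)
    (k := k) (by simp)
  have hE : ∀ x y, (1 / 2 : ℂ) • ((1 - (κ : ℂ) • pen x y₀ .alice) +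
      (1 - (κ : ℂ) • pen x₀ y .bob)) =
      1 - ((κ / 2 : ℝ) : ℂ) • (pen x y .alice + pen x y .bob) := by
    intro x y
    rw [← hpenA x y, ← hpenB x y]
    ext i j
    simp
    ring
  have hδ : δ .alice + δ .bob = w := by
    dsimp only [δ]
    cases turn R <;> simp
  have hsum : ∀ g : ℕ → ℝ,
      ∑ t ∈ s .alice, g t + ∑ t ∈ s .bob, g t = ∑ t ∈ Finset.range R, g t := by
    intro g
    have hbob : s .bob = (Finset.range R).filter fun t => ¬ turn t = .alice := by
      refine Finset.filter_congr fun t _ => ?_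
      cases turn t <;> simp
    rw [hbob]
    exact Finset.sum_filter_add_sum_filter_not _ _ _
  have hR : (0 : ℝ) < R + 1 := by positivity
  refine ⟨Qubits k, inferInstance, inferInstance, _, by simp, hmix, fun x y =>
    ⟨fun hxy => ?_, fun hxy => ?_⟩⟩
  · obtain ⟨ρ, hρ, h1⟩ := hyes x y hxy
    set h := history R J (K x y) with hh
    have hhh := hJ.history_conjTranspose_mul (hK x y)
    rw [← hh] at hhh
    have hR' : (R : ℂ) + 1 ≠ 0 := by exact_mod_cast hR.ne'
    refine ⟨((1 / (R + 1) : ℝ) : ℂ) • (h * ρ * hᴴ), ⟨(hρ.1.mul_mul_conjTranspose_same h).smul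
      (by exact_mod_cast (by positivity)), ?_⟩, ?_⟩
    · rw [trace_smul, trace_mul_comm, ← Matrix.mul_assoc, hhh, Matrix.smul_mul, Matrix.one_mul,
        trace_smul, hρ.2]
      push_cast
      simp only [smul_eq_mul]
      field_simp
    · have h2 : ((pen x y .alice + pen x y .bob) * (h * ρ * hᴴ)).trace =
          (w : ℂ) * ((evolution (K x y) R)ᴴ * Z x y * evolution (K x y) R * ρ).trace := by
        rw [← Matrix.mul_assoc, trace_mul_comm, ← Matrix.mul_assoc, ← Matrix.mul_assoc,
          Matrix.mul_add, Matrix.add_mul, hJ.penalty_history (hs _), hJ.penalty_history (hs _),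
          ← add_smul, ← Complex.ofReal_add, hδ, Matrix.smul_mul, trace_smul, smul_eq_mul]
      have h3 : (h * ρ * hᴴ).trace = (R : ℂ) + 1 := by
        rw [trace_mul_comm, ← Matrix.mul_assoc, hhh, Matrix.smul_mul, Matrix.one_mul, trace_smul,
          hρ.2, smul_eq_mul, mul_one]
      rw [hE, Matrix.mul_smul, trace_smul, Matrix.sub_mul, Matrix.one_mul, Matrix.smul_mul,
        trace_sub, trace_smul, h2, h3]
      set z := ((evolution (K x y) R)ᴴ * Z x y * evolution (K x y) R * ρ).trace
      obtain ⟨h4, h5⟩ := Complex.le_def.1 h1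
      have h6 : z = ((z.re : ℝ) : ℂ) := Complex.ext rfl (by simpa using h5)
      rw [h6]
      rw [Complex.ofReal_re] at h4
      simp only [smul_eq_mul]
      norm_cast
      have h7 : 1 / ((R : ℝ) + 1) * ((R : ℝ) + 1 - κ / 2 * (w * z.re)) =
          1 - κ * w * z.re / (2 * (R + 1)) := by
        field_simp
      -- The 6 is the 2 of the coin times the 3 of the rejection probability 1/3. In the soundness
      -- case the 4 is this 2 times the 2 in `le_quadForm_penalty`; `4 < 6` is the gap.
      have h8 : κ * w / (6 * (R + 1)) = κ * w * (1 / 3) / (2 * ((R : ℝ) + 1)) := by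
        field_simp
        norm_num
      push_cast
      rw [h7, h8]
      gcongr
  · rw [hE]
    refine IsHermitian.posSemidef_of_quadForm ?_ fun v => ?_
    · have hpen : ∀ p, (pen x y p).IsHermitian := fun p =>
        (penalty_posSemidef hJ (hZ x y) (s p) (hδ0 p)).1
      have hsm : ∀ (c : ℝ) (M : Matrix (Qubits k) (Qubits k) ℂ), M.IsHermitian →
          ((c : ℂ) • M).IsHermitian := fun c M hM => by
        rw [IsHermitian, conjTranspose_smul, hM.eq, Complex.star_def, Complex.conj_ofReal]
      exact (hsm _ _ isHermitian_one).sub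
        (isHermitian_one.sub (hsm _ _ ((hpen .alice).add (hpen .bob))))
    · have h1 := le_quadForm_penalty hJ (hK x y) (hZ x y) (hno x y hxy) v
      have h2 := hsum fun t => normSqVec (defect J (K x y) t *ᵥ v)
      rw [quadForm_sub, quadForm_sub, quadForm_smul, quadForm_smul, quadForm_one, quadForm_add]
      simp only [pen, quadForm_penalty]
      have h3 := mul_le_mul_of_nonneg_left h1 (show 0 ≤ κ / 2 by positivity)
      rw [← h2, ← hw, ← hδ] at h3
      have h4 : κ * w / (4 * (R + 1)) = κ / 2 * (w / (2 * ((R : ℝ) + 1))) := by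
        field_simp
        norm_num
      rw [h4, ← hδ]
      nlinarith

end HistoryState

/-! ### Compression of private registers -/

/-- The columns of a matrix lie in the range of an isometry from a space of dimension `d`, if `d`
is at least the number of columns or the number of rows. -/
theorem Matrix.exists_isometry_fixing {W D : Type} [Fintype W] [Fintype D] (N : Matrix W D ℂ)
    {d : ℕ} (hd : d ≤ Fintype.card W) (hN : Fintype.card D ≤ d ∨ Fintype.card W ≤ d) :
    ∃ J : Matrix W (Fin d) ℂ, Jᴴ * J = 1 ∧ J * Jᴴ * N = N := by
  classical
  let e := Fintype.equivFin D
  let col : D → EuclideanSpace ℂ W := fun c => WithLp.toLp 2 fun w => N w c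
  -- The columns come first, padded by zeros, so by triangularity the first `d` Gram–Schmidt vectors
  -- span them. If there are more columns than rows, some are dropped, but then `d` is the full
  -- dimension.
  let g : Fin (Fintype.card W) → EuclideanSpace ℂ W := fun i =>
    if h : (i : ℕ) < Fintype.card D then col (e.symm ⟨i, h⟩) else 0
  have hfin : Module.finrank ℂ (EuclideanSpace ℂ W) = Fintype.card (Fin (Fintype.card W)) := by
    simp
  let b := InnerProductSpace.gramSchmidtOrthonormalBasis hfin g
  refine ⟨Matrix.of fun w j => b (Fin.castLE hd j) w, ?_, ?_⟩
  · ext i j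
    have := orthonormal_iff_ite.1 b.orthonormal (Fin.castLE hd i) (Fin.castLE hd j)
    rw [PiLp.inner_apply] at this
    simp only [Matrix.mul_apply, conjTranspose_apply, of_apply, one_apply]
    simp only [Fin.castLE_inj] at this
    rw [← this]
    exact Finset.sum_congr rfl fun w _ => by simp [mul_comm]
  · ext w c
    have h1 : ∑ i, inner ℂ (b i) (col c) * b i w = N w c := by
      have := congrArg (fun v : EuclideanSpace ℂ W => v w) (b.sum_repr' (col c))
      simpa [col] using this
    have h2 : ∑ j : Fin d, inner ℂ (b (Fin.castLE hd j)) (col c) * b (Fin.castLE hd j) w =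
        ∑ i, inner ℂ (b i) (col c) * b i w := by
      refine Finset.sum_of_injOn (Fin.castLE hd) (Fin.castLE_injective hd).injOn (by simp) ?_
        fun _ _ => rfl
      intro i _ hi
      have hi' : d ≤ i := by
        by_contra h
        exact hi ⟨⟨i, not_le.1 h⟩, by simp, by ext; rfl⟩
      have hcard : Fintype.card D ≤ d := hN.resolve_right fun h => by omega
      have hlt : (e c : ℕ) < i := (e c).isLt.trans_le (hcard.trans hi')
      have h3 := InnerProductSpace.gramSchmidtOrthonormalBasis_inv_triangular hfin g
        (i := ⟨e c, hlt.trans i.isLt⟩) (j := i) hlt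
      have h4 : g ⟨e c, hlt.trans i.isLt⟩ = col c := by simp [g]
      rw [h4] at h3
      rw [h3, zero_mul]
    rw [← h1, ← h2, Matrix.mul_assoc]
    simp only [Matrix.mul_apply, conjTranspose_apply, of_apply]
    refine Finset.sum_congr rfl fun j _ => ?_
    rw [mul_comm, PiLp.inner_apply]
    congr 1
    exact Finset.sum_congr rfl fun w _ => by simp [col, mul_comm]

open Classical in
/-- An isometry from a `d`-dimensional space whose range contains the columns of `N`. -/
noncomputable def Matrix.columnIsometry {W D : Type} [Fintype W] [Fintype D] (N : Matrix W D ℂ)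
    (d : ℕ) : Matrix W (Fin d) ℂ :=
  if h : ∃ J : Matrix W (Fin d) ℂ, Jᴴ * J = 1 ∧ J * Jᴴ * N = N then h.choose else 0

theorem Matrix.columnIsometry_spec {W D : Type} [Fintype W] [Fintype D] (N : Matrix W D ℂ) {d : ℕ}
    (hd : d ≤ Fintype.card W) (hN : Fintype.card D ≤ d ∨ Fintype.card W ≤ d) :
    (N.columnIsometry d)ᴴ * N.columnIsometry d = 1 ∧
      N.columnIsometry d * (N.columnIsometry d)ᴴ * N = N := by
  have h := N.exists_isometry_fixing hd hN
  rw [columnIsometry, dif_pos h]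
  exact h.choose_spec

section Regroup

variable {A A' B B' C C' : Type}

/-- Move the second row index to the columns. -/
def Matrix.regroup (M : Matrix (A × B) C ℂ) : Matrix A (B × C) ℂ :=
  Matrix.of fun a c => M (a, c.1) c.2

/-- The columns of `M.regroup` span the states which the first register can reach, whatever the
second contains. A projection that fixes them therefore fixes `M` when applied to the first register
only. -/
theorem Matrix.mul_regroup [Fintype A] [Fintype B] [DecidableEq B] (T : Matrix A' A ℂ)
    (M : Matrix (A × B) C ℂ) :
    T * M.regroup = ((T ⊗ₖ (1 : Matrix B B ℂ)) * M).regroup := by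
  ext a ⟨b, c⟩
  simp only [regroup, Matrix.mul_apply, of_apply, kroneckerMap_apply, Fintype.sum_prod_type,
    one_apply]
  refine Finset.sum_congr rfl fun a' _ => ?_
  rw [Finset.sum_eq_single b (fun b' _ h => by simp [Ne.symm h]) (by simp)]
  simp

theorem Matrix.regroup_injective : Function.Injective (regroup (A := A) (B := B) (C := C)) := by
  intro M N h
  ext ⟨a, b⟩ c
  exact congrFun (congrFun h a) (b, c)

/-- The exchange of the two players' registers. -/
def swapEquiv (A B C : Type) : (A × B) × C ≃ (C × B) × A where
  toFun s := ((s.2, s.1.2), s.1.1)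
  invFun s := ((s.2, s.1.2), s.1.1)
  left_inv _ := rfl
  right_inv _ := rfl

/-- The operation `U` of the acting player on the own register and the message, and the operation
`V` of the other player, who acts next. -/
def swapStep (U : Matrix (A' × B') (A × B) ℂ) (V : Matrix C' C ℂ) :
    Matrix ((C' × B') × A') ((A × B) × C) ℂ :=
  (U ⊗ₖ V).submatrix (swapEquiv C' B' A') id

variable [Fintype A] [Fintype A'] [Fintype B] [Fintype B'] [Fintype C] [Fintype C']
  [DecidableEq A] [DecidableEq B] [DecidableEq B'] [DecidableEq C]

theorem swapStep_isometry {U : Matrix (A' × B') (A × B) ℂ} {V : Matrix C' C ℂ}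
    (hU : Uᴴ * U = 1) (hV : Vᴴ * V = 1) : (swapStep U V)ᴴ * swapStep U V = 1 := by
  rw [swapStep, conjTranspose_submatrix, submatrix_mul_equiv, conjTranspose_kronecker,
    ← mul_kronecker_mul, hU, hV, one_kronecker_one, submatrix_id_id]

theorem swapStep_mul {D E : Type} (U : Matrix (A' × B') (A × B) ℂ) (V : Matrix C' C ℂ)
    (J : Matrix A D ℂ) (L : Matrix C E ℂ) :
    swapStep U V * ((J ⊗ₖ (1 : Matrix B B ℂ)) ⊗ₖ L) =
      swapStep (U * (J ⊗ₖ (1 : Matrix B B ℂ))) (V * L) := by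
  rw [swapStep, swapStep, mul_kronecker_mul, ← submatrix_id_id ((J ⊗ₖ (1 : Matrix B B ℂ)) ⊗ₖ L)]
  exact submatrix_mul_equiv _ _ _ (Equiv.refl _) _

theorem mul_swapStep {D E : Type} (U : Matrix (A' × B') (A × B) ℂ) (V : Matrix C' C ℂ)
    (J : Matrix D A' ℂ) (L : Matrix E C' ℂ) :
    ((L ⊗ₖ (1 : Matrix B' B' ℂ)) ⊗ₖ J) * swapStep U V =
      swapStep ((J ⊗ₖ (1 : Matrix B' B' ℂ)) * U) (L * V) := by
  rw [swapStep, swapStep, mul_kronecker_mul, ← submatrix_mul_equiv _ _ _ (swapEquiv C' B' A')]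
  congr 1
  ext ⟨⟨i, j⟩, k⟩ ⟨⟨i', j'⟩, k'⟩
  simp [swapEquiv, kroneckerMap_apply]
  ring

end Regroup

/-! ### The compressed protocol -/

namespace QMAProtocol

variable {X Y : Type} (P : QMAProtocol X Y)

/-- The dimension to which the private register `work i` can be compressed. -/
def dim : ℕ → ℕ
  | 0 => 2 ^ P.work 0
  | 1 => 2 ^ P.work 1
  | i + 2 => min (2 ^ P.msg (i + 1) * (dim i * 2 ^ P.msg i)) (2 ^ P.work (i + 2))

/-- The isometry which decompresses the private register `work i`. Its range contains all
reachable states of the register. -/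
noncomputable def decompress (x : X) (y : Y) :
    (i : ℕ) → Matrix (Qubits (P.work i)) (Fin (P.dim i)) ℂ
  | 0 => columnIsometry (1 : Matrix (Qubits (P.work 0)) (Qubits (P.work 0)) ℂ) _
  | 1 => columnIsometry (1 : Matrix (Qubits (P.work 1)) (Qubits (P.work 1)) ℂ) _
  | i + 2 => columnIsometry (regroup (P.op i (Player.view x y (P.first.turn i)) *
      (decompress x y i ⊗ₖ (1 : Matrix (Qubits (P.msg i)) (Qubits (P.msg i)) ℂ)))) _

theorem decompress_isometry (x : X) (y : Y) (i : ℕ) :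
    (P.decompress x y i)ᴴ * P.decompress x y i = 1 := by
  match i with
  | 0 => exact (columnIsometry_spec _ (by simp [dim]) (by simp [dim])).1
  | 1 => exact (columnIsometry_spec _ (by simp [dim]) (by simp [dim])).1
  | i + 2 =>
    refine (columnIsometry_spec _ (by simp [dim]) ?_).1
    simpa [dim] using le_total _ _

/-- Merlin's part is not compressed at all: here the isometry is unitary, so every proof of the
original protocol has a counterpart in the compressed one. -/
theorem decompress_zero (x : X) (y : Y) :
    P.decompress x y 0 * (P.decompress x y 0)ᴴ = 1 := by
  have := (columnIsometry_spec (1 : Matrix (Qubits (P.work 0)) (Qubits (P.work 0)) ℂ) (d := P.dim 0)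
    (by simp [dim])
    (by simp [dim])).2
  rwa [Matrix.mul_one] at this

theorem decompress_one (x : X) (y : Y) :
    P.decompress x y 1 * (P.decompress x y 1)ᴴ = 1 := by
  have := (columnIsometry_spec (1 : Matrix (Qubits (P.work 1)) (Qubits (P.work 1)) ℂ) (d := P.dim 1)
    (by simp [dim])
    (by simp [dim])).2
  rwa [Matrix.mul_one] at this

theorem _root_.Player.other_other (p : Player) : p.other.other = p := by
  cases p <;> rfl

theorem _root_.Player.turn_add_two (p : Player) (i : ℕ) : p.turn (i + 2) = p.turn i :=
  Player.other_other _

/-- The recursion goes back two steps, to the previous action of the same player, and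
`columnIsometry` is a function of the matrix alone. So the compression is known to the owner of the
register. -/
theorem decompress_congr {x x' : X} {y y' : Y} (i : ℕ)
    (h : Player.view x y (P.first.turn i) = Player.view x' y' (P.first.turn i)) :
    P.decompress x y i = P.decompress x' y' i := by
  match i with
  | 0 => rfl
  | 1 => rfl
  | i + 2 =>
    rw [Player.turn_add_two] at h
    rw [decompress, decompress, h, decompress_congr i h]

/-- The stages of the compressed protocol. -/
abbrev CompressedStage (i : ℕ) : Type :=
  (Fin (P.dim i) × Qubits (P.msg i)) × Fin (P.dim (i + 1))

/-- The isometry which decompresses the register of the acting player. -/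
noncomputable def decompressActing (x : X) (y : Y) (i : ℕ) :
    Matrix (Qubits (P.work i) × Qubits (P.msg i)) (Fin (P.dim i) × Qubits (P.msg i)) ℂ :=
  P.decompress x y i ⊗ₖ 1

/-- The isometry which decompresses the registers of both players. -/
noncomputable def decompressStage (x : X) (y : Y) (i : ℕ) :
    Matrix (P.Stage i) (P.CompressedStage i) ℂ :=
  P.decompressActing x y i ⊗ₖ P.decompress x y (i + 1)

theorem decompressActing_isometry (x : X) (y : Y) (i : ℕ) :
    (P.decompressActing x y i)ᴴ * P.decompressActing x y i = 1 := by
  rw [decompressActing, conjTranspose_kronecker, ← mul_kronecker_mul, decompress_isometry,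
    conjTranspose_one, Matrix.mul_one, one_kronecker_one]

theorem decompressStage_isometry (x : X) (y : Y) (i : ℕ) :
    (P.decompressStage x y i)ᴴ * P.decompressStage x y i = 1 := by
  rw [decompressStage, conjTranspose_kronecker, ← mul_kronecker_mul, decompress_isometry,
    decompressActing_isometry, one_kronecker_one]

theorem decompressStage_zero (x : X) (y : Y) :
    P.decompressStage x y 0 * (P.decompressStage x y 0)ᴴ = 1 := by
  rw [decompressStage, decompressActing, conjTranspose_kronecker, conjTranspose_kronecker,
    ← mul_kronecker_mul, ← mul_kronecker_mul, conjTranspose_one, Matrix.mul_one, decompress_zero,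
    decompress_one, one_kronecker_one, one_kronecker_one]

/-- The operation of the acting player in the compressed protocol. -/
noncomputable def compressedOp (x : X) (y : Y) (i : ℕ) :
    Matrix (Fin (P.dim (i + 2)) × Qubits (P.msg (i + 1))) (Fin (P.dim i) × Qubits (P.msg i)) ℂ :=
  (P.decompress x y (i + 2) ⊗ₖ (1 : Matrix (Qubits (P.msg (i + 1))) (Qubits (P.msg (i + 1))) ℂ))ᴴ *
    (P.op i (Player.view x y (P.first.turn i)) * P.decompressActing x y i)

/-- The evolution of the compressed protocol from time `i` to time `i + 1`. -/
noncomputable def compressedStep (x : X) (y : Y) (i : ℕ) :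
    Matrix (P.CompressedStage (i + 1)) (P.CompressedStage i) ℂ :=
  swapStep (P.compressedOp x y i) 1

/-- The effect "reject" of the compressed protocol. -/
noncomputable def compressedReject (x : X) (y : Y) :
    Matrix (P.CompressedStage P.rounds) (P.CompressedStage P.rounds) ℂ :=
  ((P.decompressActing x y P.rounds)ᴴ * (1 - P.accept (Player.view x y (P.first.turn P.rounds))) *
    P.decompressActing x y P.rounds) ⊗ₖ 1

/-- The effect "reject" of the protocol. -/
noncomputable def reject (x : X) (y : Y) : Matrix (P.Stage P.rounds) (P.Stage P.rounds) ℂ :=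
  (1 - P.accept (Player.view x y (P.first.turn P.rounds))) ⊗ₖ 1

/-- Compressing after the operation loses nothing, since the range of the new isometry contains all
states that the operation produces in the private register. -/
theorem decompress_mul_compressedOp (x : X) (y : Y) (i : ℕ) :
    (P.decompress x y (i + 2) ⊗ₖ
        (1 : Matrix (Qubits (P.msg (i + 1))) (Qubits (P.msg (i + 1))) ℂ)) * P.compressedOp x y i =
      P.op i (Player.view x y (P.first.turn i)) * P.decompressActing x y i := by
  rw [compressedOp, ← Matrix.mul_assoc, conjTranspose_kronecker, ← mul_kronecker_mul,
    conjTranspose_one, Matrix.mul_one]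
  apply regroup_injective
  rw [← mul_regroup]
  refine (columnIsometry_spec _ (by simp [dim]) ?_).2
  simpa [dim] using le_total _ _

theorem step_eq_swapStep (x : X) (y : Y) (i : ℕ) :
    P.step x y i = swapStep (P.op i (Player.view x y (P.first.turn i))) 1 := by
  ext s t
  simp [step, swapStep, swapEquiv, kroneckerMap_apply, one_apply]

/-- Decompression intertwines the two protocols; this transfers isometry and acceptance
probabilities from one to the other. -/
theorem decompressStage_mul_compressedStep (x : X) (y : Y) (i : ℕ) :
    P.decompressStage x y (i + 1) * P.compressedStep x y i =
      P.step x y i * P.decompressStage x y i := by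
  rw [step_eq_swapStep, compressedStep, decompressStage, decompressStage, decompressActing,
    mul_swapStep, decompress_mul_compressedOp, decompressActing, swapStep_mul, Matrix.mul_one,
    Matrix.one_mul]

theorem step_isometry (x : X) (y : Y) {i : ℕ} (hi : i < P.rounds) :
    (P.step x y i)ᴴ * P.step x y i = 1 := by
  rw [step_eq_swapStep]
  exact swapStep_isometry (P.op_isometry i hi _) (by simp)

theorem compressedStep_isometry (x : X) (y : Y) {i : ℕ} (hi : i < P.rounds) :
    (P.compressedStep x y i)ᴴ * P.compressedStep x y i = 1 := by
  have h : ∀ K : Matrix (P.CompressedStage (i + 1)) (P.CompressedStage i) ℂ, Kᴴ * K =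
      (P.decompressStage x y (i + 1) * K)ᴴ * (P.decompressStage x y (i + 1) * K) := by
    intro K
    rw [conjTranspose_mul, Matrix.mul_assoc, ← Matrix.mul_assoc _ _ K, decompressStage_isometry,
      Matrix.one_mul]
  rw [h, decompressStage_mul_compressedStep, conjTranspose_mul, Matrix.mul_assoc,
    ← Matrix.mul_assoc _ (P.step x y i), step_isometry P x y hi, Matrix.one_mul,
    decompressStage_isometry]

theorem evolve_eq_evolution (x : X) (y : Y) (i : ℕ) :
    P.evolve x y i = HistoryState.evolution (P.step x y) i := by
  induction i with
  | zero => rfl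
  | succ i ih => rw [evolve, ih, HistoryState.evolution]

theorem decompressStage_mul_evolution (x : X) (y : Y) (i : ℕ) :
    P.decompressStage x y i * HistoryState.evolution (P.compressedStep x y) i =
      P.evolve x y i * P.decompressStage x y 0 := by
  induction i with
  | zero => simp [HistoryState.evolution, evolve]
  | succ i ih =>
    rw [HistoryState.evolution, evolve, ← Matrix.mul_assoc, decompressStage_mul_compressedStep,
      Matrix.mul_assoc, ih, Matrix.mul_assoc]

theorem compressedReject_eq (x : X) (y : Y) : P.compressedReject x y =
    (P.decompressStage x y P.rounds)ᴴ * P.reject x y * P.decompressStage x y P.rounds := by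
  rw [decompressStage, reject, conjTranspose_kronecker, ← mul_kronecker_mul, ← mul_kronecker_mul,
    Matrix.mul_one, decompress_isometry, compressedReject]

theorem compressedReject_isEffect (x : X) (y : Y) : IsEffect (P.compressedReject x y) :=
  ((P.accept_effect _).one_sub.conj (P.decompressActing_isometry x y _)).kronecker
    ⟨PosSemidef.one, by simpa using PosSemidef.zero⟩

/-- The effect "reject" on Merlin's proof. -/
noncomputable def rejectProof (x : X) (y : Y) : Matrix (P.Stage 0) (P.Stage 0) ℂ :=
  (P.evolve x y P.rounds)ᴴ * P.reject x y * P.evolve x y P.rounds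

theorem rejectProof_posSemidef (x : X) (y : Y) : (P.rejectProof x y).PosSemidef :=
  ((P.accept_effect _).2.complex_kronecker PosSemidef.one).conjTranspose_mul_mul_same _

theorem compressedReject_evolution (x : X) (y : Y) :
    (HistoryState.evolution (P.compressedStep x y) P.rounds)ᴴ * P.compressedReject x y *
      HistoryState.evolution (P.compressedStep x y) P.rounds =
    (P.decompressStage x y 0)ᴴ * P.rejectProof x y * P.decompressStage x y 0 := by
  have h1 := P.decompressStage_mul_evolution x y P.rounds
  have h2 := congrArg conjTranspose h1
  rw [conjTranspose_mul, conjTranspose_mul] at h2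
  rw [compressedReject_eq, rejectProof, Matrix.mul_assoc _ (_ * _ * _), Matrix.mul_assoc (_ * _), h1,
    Matrix.mul_assoc, ← Matrix.mul_assoc _ (_ᴴ), h2]
  simp only [Matrix.mul_assoc]

theorem trace_rejectProof_mul (x : X) (y : Y) {ρ : Matrix (P.Stage 0) (P.Stage 0) ℂ}
    (hρ : IsState ρ) : (P.rejectProof x y * ρ).trace = ((1 - P.acceptProb x y ρ : ℝ) : ℂ) := by
  have h1 : (P.evolve x y P.rounds)ᴴ * P.evolve x y P.rounds = 1 := by
    rw [evolve_eq_evolution]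
    exact HistoryState.evolution_isometry (fun _ => P.step_isometry x y) le_rfl
  have h2 := (P.rejectProof_posSemidef x y).trace_mul_nonneg hρ.1
  refine Complex.ext ?_ (by simpa using (Complex.le_def.1 h2).2.symm)
  rw [Complex.ofReal_re, acceptProb, rejectProof, reject, sub_eq_add_neg, ← neg_one_smul ℂ,
    add_kronecker, smul_kronecker, one_kronecker_one, Matrix.mul_add, Matrix.add_mul,
    Matrix.mul_one, h1, Matrix.mul_smul, Matrix.smul_mul, neg_one_smul, Matrix.add_mul,
    Matrix.one_mul, trace_add, hρ.2, Matrix.neg_mul, trace_neg, Complex.add_re, Complex.neg_re,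
    Complex.one_re, ← sub_eq_add_neg]
  congr 2
  rw [Matrix.mul_assoc, Matrix.mul_assoc, trace_mul_comm]
  simp only [Matrix.mul_assoc]

theorem exists_state_of_acceptProb {x : X} {y : Y} {ρ : Matrix (P.Stage 0) (P.Stage 0) ℂ}
    (hρ : IsState ρ) (h : 2 / 3 ≤ P.acceptProb x y ρ) : ∃ σ, IsState σ ∧
      ((HistoryState.evolution (P.compressedStep x y) P.rounds)ᴴ * P.compressedReject x y *
        HistoryState.evolution (P.compressedStep x y) P.rounds * σ).trace ≤ ((1 / 3 : ℝ) : ℂ) := by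
  set V := P.decompressStage x y 0 with hV
  have hVV : V * Vᴴ = 1 := P.decompressStage_zero x y
  have hσ := hρ.conj (V := Vᴴ) (by rw [conjTranspose_conjTranspose, hVV])
  rw [conjTranspose_conjTranspose] at hσ
  refine ⟨_, hσ, ?_⟩
  rw [compressedReject_evolution, ← hV, show Vᴴ * P.rejectProof x y * V * (Vᴴ * ρ * V) =
    Vᴴ * (P.rejectProof x y * (V * Vᴴ) * ρ * V) by simp only [Matrix.mul_assoc], trace_mul_comm,
    hVV, Matrix.mul_one, Matrix.mul_assoc, hVV, Matrix.mul_one, trace_rejectProof_mul P x y hρ]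
  rw [Complex.real_le_real]
  linarith

/-- Soundness for the pure state along the decompressed vector, scaled to any length. -/
theorem le_quadForm_of_acceptProb {x : X} {y : Y}
    (h : ∀ ρ, IsState ρ → P.acceptProb x y ρ ≤ 1 / 3) (u : P.CompressedStage 0 → ℂ) :
    2 / 3 * normSqVec u ≤ quadForm (P.compressedReject x y)
      (HistoryState.evolution (P.compressedStep x y) P.rounds *ᵥ u) := by
  rw [← quadForm_conj, compressedReject_evolution, quadForm_conj,
    ← normSqVec_mulVec_of_isometry (P.decompressStage_isometry x y 0) u]
  generalize P.decompressStage x y 0 *ᵥ u = v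
  rcases (normSqVec_nonneg v).eq_or_lt with h0 | h0
  · rw [← h0, mul_zero]
    exact (P.rejectProof_posSemidef x y).quadForm_nonneg v
  · have hdot : star v ⬝ᵥ v = ((normSqVec v : ℝ) : ℂ) := by
      simp [dotProduct, normSqVec, Complex.normSq_eq_conj_mul_self]
    have hρ : IsState (((1 / normSqVec v : ℝ) : ℂ) • vecMulVec v (star v)) := by
      refine ⟨(posSemidef_vecMulVec_self_star v).smul (by exact_mod_cast (by positivity)), ?_⟩
      rw [trace_smul, trace_vecMulVec, dotProduct_comm, hdot, smul_eq_mul, ← Complex.ofReal_mul,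
        one_div_mul_cancel h0.ne', Complex.ofReal_one]
    have h1 := congrArg Complex.re (P.trace_rejectProof_mul x y hρ)
    rw [Matrix.mul_smul, trace_smul, mul_vecMulVec, trace_vecMulVec, dotProduct_comm, smul_eq_mul,
      Complex.re_ofReal_mul, Complex.ofReal_re] at h1
    have h2 := h _ hρ
    change 1 / normSqVec v * quadForm (P.rejectProof x y) v = _ at h1
    have h3 : 2 / 3 ≤ 1 / normSqVec v * quadForm (P.rejectProof x y) v := by linarith
    rw [one_div, ← div_eq_inv_mul, le_div_iff₀ h0] at h3
    exact h3

/-- The sum stops before `msg i`: the register `work i` was produced at time `i - 2`, together with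
the message `msg (i - 1)`. -/
theorem dim_le (i : ℕ) :
    P.dim i ≤ 2 ^ (P.work 0 + P.work 1 + ∑ j ∈ Finset.range i, P.msg j) := by
  match i with
  | 0 => exact Nat.pow_le_pow_right two_pos (by omega)
  | 1 => exact Nat.pow_le_pow_right two_pos (by omega)
  | i + 2 =>
    refine (min_le_left _ _).trans ?_
    rw [Finset.sum_range_succ, Finset.sum_range_succ, ← add_assoc, ← add_assoc, pow_add, pow_add,
      mul_comm]
    exact Nat.mul_le_mul_right _ (Nat.mul_le_mul_right _ (dim_le i))

theorem sum_msg_le {i : ℕ} (hi : i ≤ P.rounds + 1) :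
    P.work 0 + P.work 1 + ∑ j ∈ Finset.range i, P.msg j ≤ P.cost := by
  refine Nat.add_le_add_left ((Finset.sum_le_sum_of_subset (Finset.range_mono hi)).trans ?_) _
  rw [Finset.sum_range_succ', P.msg_zero, add_zero]

theorem card_compressedStage_le :
    ∑ t : Fin (P.rounds + 1), Fintype.card (P.CompressedStage t) ≤
      2 ^ (P.rounds + 3 * P.cost) := by
  have h : ∀ t : Fin (P.rounds + 1), Fintype.card (P.CompressedStage t) ≤ 2 ^ (3 * P.cost) := by
    intro t
    have ht := t.isLt
    have h1 : ∀ i ≤ P.rounds + 1, P.dim i ≤ 2 ^ P.cost := fun i hi =>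
      (P.dim_le i).trans (Nat.pow_le_pow_right two_pos (P.sum_msg_le hi))
    have h2 : 2 ^ P.msg t ≤ 2 ^ P.cost := by
      refine Nat.pow_le_pow_right two_pos (le_trans ?_ (P.sum_msg_le le_rfl))
      exact (Finset.single_le_sum (f := P.msg) (fun _ _ => Nat.zero_le _)
        (Finset.mem_range.2 ht)).trans (Nat.le_add_left _ _)
    have h3 := Nat.mul_le_mul (Nat.mul_le_mul (h1 t ht.le) h2) (h1 (t + 1) ht)
    simpa [← pow_add, show P.cost + P.cost + P.cost = 3 * P.cost by ring] using h3
  refine (Finset.sum_le_sum fun t _ => h t).trans ?_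
  rw [Finset.sum_const, Finset.card_univ, Fintype.card_fin, smul_eq_mul, pow_add]
  -- The number of stages satisfies `R + 1 ≤ 2 ^ R`.
  exact Nat.mul_le_mul_right _ (Nat.lt_two_pow_self (n := P.rounds))

theorem hasOneWayProtocol [Nonempty X] [Nonempty Y] {f : X → Y → Option Bool}
    (hf : P.Computes f) : HasOneWayProtocol f
      (1 - 1 / (4 * P.rounds + 2) * (1 / (16 * 2 ^ P.rounds)) / (6 * (P.rounds + 1)))
      (1 - 1 / (4 * P.rounds + 2) * (1 / (16 * 2 ^ P.rounds)) / (4 * (P.rounds + 1)))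
      (P.rounds + 3 * P.cost) (P.rounds + 3 * P.cost + 2) := by
  have hviewA : ∀ {p : Player}, p = .alice → ∀ (x : X) (y y' : Y),
      Player.view x y p = Player.view x y' p := by
    rintro _ rfl x y y'
    rfl
  have hviewB : ∀ {p : Player}, p = .bob → ∀ (x x' : X) (y : Y),
      Player.view x y p = Player.view x' y p := by
    rintro _ rfl x x' y
    rfl
  have hstep : ∀ (t : ℕ) {x x' : X} {y y' : Y},
      Player.view x y (P.first.turn t) = Player.view x' y' (P.first.turn t) →
      P.compressedStep x y t = P.compressedStep x' y' t := by
    intro t x x' y y' h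
    have h2 : P.decompress x y (t + 2) = P.decompress x' y' (t + 2) :=
      P.decompress_congr _ (by rwa [Player.turn_add_two])
    rw [compressedStep, compressedStep, compressedOp, compressedOp, decompressActing,
      decompressActing, h, P.decompress_congr t h, h2]
  have hreject : ∀ {x x' : X} {y y' : Y},
      Player.view x y (P.first.turn P.rounds) = Player.view x' y' (P.first.turn P.rounds) →
      P.compressedReject x y = P.compressedReject x' y' := by
    intro x x' y y' h
    rw [compressedReject, compressedReject, decompressActing, decompressActing, h,
      P.decompress_congr _ h]
  exact HistoryState.hasOneWayProtocol f P.first.turn P.compressedStep P.compressedReject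
    (fun t _ ht x y y' => hstep t (hviewA ht x y y'))
    (fun t _ ht x x' y => hstep t (hviewB ht x x' y))
    (fun hR x y y' => hreject (hviewA hR x y y')) (fun hR x x' y => hreject (hviewB hR x x' y))
    (fun x y t ht => P.compressedStep_isometry x y ht) P.compressedReject_isEffect
    P.card_compressedStage_le
    (fun x y hxy => by
      obtain ⟨ρ, hρ, h⟩ := (hf x y).1 hxy
      exact P.exists_state_of_acceptProb hρ h)
    fun x y hxy => P.le_quadForm_of_acceptProb ((hf x y).2 hxy)

end QMAProtocol

/-! ### The final constant -/

theorem exists_oneWayQMA_le (R : ℕ) : ∃ C : ℕ, ∀ {X Y : Type} [Nonempty X] [Nonempty Y]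
    (f : X → Y → Option Bool) (P : QMAProtocol X Y), P.Computes f → P.rounds = R → ∀ c : ℕ,
      1 ≤ c → P.cost ≤ c → oneWayQMA f ≤ ((C * c : ℕ) : ℕ∞) := by
  set g : ℝ := 1 / (4 * R + 2) * (1 / (16 * 2 ^ R)) with hg
  have hg0 : 0 < g := by positivity
  have hR : (0 : ℝ) < R + 1 := by positivity
  have hg1 : g ≤ 1 := by
    have h1 : 1 / (4 * (R : ℝ) + 2) ≤ 1 := by
      rw [div_le_one (by positivity)]
      linarith
    have h2 : 1 / (16 * (2 : ℝ) ^ R) ≤ 1 := by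
      rw [div_le_one (by positivity)]
      linarith [one_le_pow₀ (M₀ := ℝ) (a := 2) (by norm_num) (n := R)]
    exact mul_le_one₀ h1 (by positivity) h2
  obtain ⟨N, hN⟩ := HasOneWayProtocol.exists_amplification (α := 1 - g / (6 * (R + 1)))
    (β := 1 - g / (4 * (R + 1)))
    (by rw [sub_nonneg, div_le_one (by positivity)]; linarith)
    (by
      apply sub_lt_sub_left
      gcongr
      norm_num)
    (sub_le_self _ (by positivity))
  -- Proof and message together have `2 * R + 6 * cost + 2` qubits, and `1 ≤ c` absorbs the additive
  -- terms.
  refine ⟨N * (2 * R + 8), fun f P hf hPR c hc hPc => ?_⟩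
  subst hPR
  refine (hN f _ _ (P.hasOneWayProtocol hf)).trans ?_
  rw [Nat.cast_le, mul_assoc]
  refine Nat.mul_le_mul_left _ ?_
  nlinarith [Nat.mul_le_mul_left P.rounds hc]

theorem mainTheorem5 (r : ℕ) :
    ∃ C : ℕ, ∀ (n m : ℕ) (f : (Fin n → Bool) → (Fin m → Bool) → Option Bool) (c : ℕ),
      1 ≤ c →
      (∃ P : QMAProtocol (Fin n → Bool) (Fin m → Bool),
        P.Computes f ∧ P.rounds ≤ r ∧ P.cost ≤ c) →
      oneWayQMA f ≤ ((C * c : ℕ) : ℕ∞) := by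
  choose C hC using exists_oneWayQMA_le
  -- The sum dominates the constant for each exact number of rounds up to `r`.
  refine ⟨∑ R ∈ Finset.range (r + 1), C R, fun n m f c hc ⟨P, hf, hr, hP⟩ => ?_⟩
  refine (hC P.rounds f P hf rfl c hc hP).trans (Nat.cast_le.2 (Nat.mul_le_mul_right _ ?_))
  exact Finset.single_le_sum (f := C) (fun _ _ => Nat.zero_le _)
    (Finset.mem_range.2 (Nat.lt_succ_iff.2 hr))
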